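/- Let $n\ge 1$ be odd and let $D\subset\mathbb R^n$ be a bounded domain (a nonempty, bounded, connected open set) with $C^\infty$ boundary, i.e. near each boundary point $x$ the set $D$ is $\{\rho<0\}$ for a $C^\infty$ function $\rho$ with $d\rho_x\ne0$. For $\omega\in S^{n-1}$ put $h_D^{+}(\omega)=\sup_{x\in D}\langle\omega,x\rangle$, $h_D^{-}(\omega)=\inf_{x\in D}\langle\omega,x\rangle$, and let $V_D(\omega,t)$ be the $(n-1)$-dimensional volume of the section $D\cap\{x:\langle\omega,x\rangle=t\}$. Suppose that there are an integer $N\ge0$ and functions $a_0,\dots,a_N:S^{n-1}\to\mathbb R$ such that $$V_D(\omega,t)=a_0(\omega)+a_1(\omega)t+\cdots+a_N(\omega)t^N\qquad\text{for all }\omega\in S^{n-1},\ h_D^{-}(\omega)<t<h_D^{+}(\omega),$$ and that for each $k$ with $n-1<k\le N$ the function $a_k$ is the restriction to $S^{n-1}$ of a real polynomial on $\mathbb R^n$ of degree at most $k-n+1$. Then $D$ is an ellipsoid: there are a point $c\in\mathbb R^n$, an orthonormal basis $e_1,\dots,e_n$ of $\mathbb R^n$ and numbers $b_1,\dots,b_n>0$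 such that $$D=\Bigl\{x\in\mathbb R^n:\ \sum_{j=1}^n\frac{\langle e_j,x-c\rangle^2}{b_j^2}<1\Bigr\}.$$ -/

import Mathlib

open MeasureTheory Set

noncomputable section

/-- `D` has a `C^∞` boundary: near each boundary point `x`, `D` is the negativity set of a smooth
function whose differential does not vanish at `x` (so `D` lies locally on one side of a smooth
hypersurface). -/
def HasSmoothBoundary {n : ℕ} (D : Set (EuclideanSpace ℝ (Fin n))) : Prop :=
  ∀ x ∈ frontier D, ∃ (U : Set (EuclideanSpace ℝ (Fin n))) (ρ : EuclideanSpace ℝ (Fin n) → ℝ),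
    IsOpen U ∧ x ∈ U ∧ ContDiffOn ℝ ((⊤ : ℕ∞) : WithTop ℕ∞) ρ U ∧
      fderiv ℝ ρ x ≠ 0 ∧ ∀ y ∈ U, (y ∈ D ↔ ρ y < 0)

/-- A bounded domain (nonempty connected open set) with `C^∞` boundary. -/
structure IsSmoothBoundedDomain {n : ℕ} (D : Set (EuclideanSpace ℝ (Fin n))) : Prop where
  isOpen : IsOpen D
  isConnected : IsConnected D
  isBounded : Bornology.IsBounded D
  smoothBoundary : HasSmoothBoundary D

/-- Upper support function `h⁺_D(ω) = sup_{x ∈ D} ⟨ω, x⟩`. -/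
def upperSupport {n : ℕ} (D : Set (EuclideanSpace ℝ (Fin n)))
    (ω : EuclideanSpace ℝ (Fin n)) : ℝ :=
  sSup ((fun x => inner ℝ ω x) '' D)

/-- Lower support function `h⁻_D(ω) = inf_{x ∈ D} ⟨ω, x⟩`. -/
def lowerSupport {n : ℕ} (D : Set (EuclideanSpace ℝ (Fin n)))
    (ω : EuclideanSpace ℝ (Fin n)) : ℝ :=
  sInf ((fun x => inner ℝ ω x) '' D)

/-- The section-volume function `V_D(ω, t)` for a unit vector `ω`: the `(n-1)`-dimensional Lebesgue
measure of the section of `D` by the hyperplane `⟨ω, x⟩ = t`, whose points are `t ω + y` with `y` in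
the orthogonal complement of `ω`, a Euclidean space of dimension `n - 1`. -/
def sectionVolume {n : ℕ} (D : Set (EuclideanSpace ℝ (Fin n)))
    (ω : EuclideanSpace ℝ (Fin n)) (t : ℝ) : ℝ :=
  (volume {y : (Submodule.span ℝ {ω})ᗮ | t • ω + (y : EuclideanSpace ℝ (Fin n)) ∈ D}).toReal

/-- `D` is an (open, solid) ellipsoid with some centre `c`, orthonormal axes `e j` and semi-axes
`b j > 0`. -/
def IsEllipsoid {n : ℕ} (D : Set (EuclideanSpace ℝ (Fin n))) : Prop :=
  ∃ (c : EuclideanSpace ℝ (Fin n)) (e : OrthonormalBasis (Fin n) ℝ (EuclideanSpace ℝ (Fin n)))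
    (b : Fin n → ℝ), (∀ j, 0 < b j) ∧
      D = {x | ∑ j, (inner ℝ (e j) (x - c)) ^ 2 / (b j) ^ 2 < 1}

end

section

open Polynomial Filter Topology

/-! The hypothesis enters only through this consequence: for every `ξ ≠ 0` the image of the uniform
measure of `D` under `⟨ξ, ·⟩` has a polynomial density of degree at most `N` between `h⁻(ξ)` and
`h⁺(ξ)` (`PolyMarginals`).

The support functions are those of an ellipsoid. Move a point of `D` to the origin, so that `h⁻ < 0
< h⁺` off zero. Integrating the polynomial density shows that the `k`-th moment of `D` in direction
`ξ`, times `∏ (k + i + 1)`, has the form `α(k) h⁺(ξ)^k + β(k) h⁻(ξ)^k` with nonzero polynomials `α`,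
`β`. Along a line `ξ = x + s y` the moments are also polynomials in `s`. The minimal linear
recurrence of this sequence over `ℝ(s)` has coefficients in `ℝ[s]`, and for all but finitely many
`s` it specialises to `(X - h⁺)^p (X - h⁻)^q`. Hence `p h⁺ + q h⁻` and `p (h⁺)² + q (h⁻)²` are
polynomials in `s` (`exists_powerSums`). Continuity makes `p` constant, and since `h⁺` and `h⁻`
exchange their asymptotics between `s → ∞` and `s → -∞`, one gets `p = q` (`two_exponents_on_line`).
So `h⁺ + h⁻` is a linear form and `(h⁺ - h⁻)²` a positive definite quadratic form
(`PolyMarginals.exists_ellipsoid_supports`).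

An affine map now gives `D` the support functions of the unit ball. Let `n = 2m + 1`. As `D` lies in
the ball, its marginal density is at most the ball's, a multiple of `(1 - t²)^m`, and is therefore
`(1 - t²)^m Q(t)` with `Q` a polynomial. Polynomials restricted to the ball have Radon transforms of
the same shape; here odd dimension is essential. Let `p` be the `L²` projection of the indicator of
`D` onto such polynomials. The two Radon transforms have the same moments up to order `N`, which
determine `Q`; so they coincide, and so do the Fourier transforms. Thus the indicator is a.e. equal
to a function continuous on the connected ball, and `D` fills the ball up to a null set
(`PolyMarginals.ae_mem_of_mem_unitBall`). The smooth boundary excludes missing slits and points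
(`HasSmoothBoundary.eq_of_dense`). -/

/-- The shift operator on sequences. -/
noncomputable def seqShift (A : Type*) [CommRing A] : Module.End A (ℕ → A) :=
  LinearMap.funLeft A A Nat.succ

/-- The action of a polynomial on sequences in which `X` acts as the shift. -/
noncomputable def recAct {A : Type*} [CommRing A] (C : A[X]) : Module.End A (ℕ → A) :=
  aeval (seqShift A) C

/-! ### Linear recurrences as polynomials in the shift -/

section RecAct

variable {A : Type*} [CommRing A]

theorem seqShift_pow_apply (i : ℕ) (u : ℕ → A) (k : ℕ) :
    ((seqShift A) ^ i) u k = u (k + i) := by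
  induction i generalizing k with
  | zero => simp
  | succ i ih =>
    rw [pow_succ', Module.End.mul_apply]
    change ((seqShift A) ^ i) u (k + 1) = _
    rw [ih]
    congr 1
    omega

theorem recAct_apply (C : A[X]) (u : ℕ → A) (k : ℕ) :
    recAct C u k = ∑ i ∈ Finset.range (C.natDegree + 1), C.coeff i * u (k + i) := by
  rw [recAct, aeval_eq_sum_range, LinearMap.sum_apply, Finset.sum_apply]
  simp [seqShift_pow_apply]

theorem recAct_apply_of_natDegree_lt {C : A[X]} {n : ℕ} (h : C.natDegree < n) (u : ℕ → A) (k : ℕ) :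
    recAct C u k = ∑ i ∈ Finset.range n, C.coeff i * u (k + i) := by
  rw [recAct, aeval_eq_sum_range' h, LinearMap.sum_apply, Finset.sum_apply]
  simp [seqShift_pow_apply]

theorem recAct_mul (C D : A[X]) (u : ℕ → A) : recAct (C * D) u = recAct C (recAct D u) := by
  simp [recAct]

theorem recAct_mul_eq_zero_right {C D : A[X]} {u : ℕ → A} (h : recAct D u = 0) :
    recAct (C * D) u = 0 := by
  rw [recAct_mul, h, map_zero]

theorem recAct_mul_eq_zero_left {C D : A[X]} {u : ℕ → A} (h : recAct C u = 0) :
    recAct (C * D) u = 0 := by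
  rw [mul_comm, recAct_mul, h, map_zero]

theorem recAct_add (C D : A[X]) (u : ℕ → A) : recAct (C + D) u = recAct C u + recAct D u := by
  simp [recAct]

theorem recAct_sub (C D : A[X]) (u : ℕ → A) : recAct (C - D) u = recAct C u - recAct D u := by
  simp [recAct]

theorem recAct_one (u : ℕ → A) : recAct (1 : A[X]) u = u := by
  simp [recAct]

theorem recAct_X_sub_C (c : A) (u : ℕ → A) (k : ℕ) :
    recAct (X - C c) u k = u (k + 1) - c * u k := by
  rw [recAct, map_sub, aeval_X, aeval_C, LinearMap.sub_apply, Pi.sub_apply]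
  rfl

theorem map_recAct {B : Type*} [CommRing B] (φ : A →+* B) (C : A[X]) (u : ℕ → A) (k : ℕ) :
    recAct (C.map φ) (fun i => φ (u i)) k = φ (recAct C u k) := by
  rw [recAct_apply C,
    recAct_apply_of_natDegree_lt (n := C.natDegree + 1) (Nat.lt_succ_of_le natDegree_map_le)]
  simp

/-- A sequence killed by a monic polynomial of degree at most `r` and vanishing at its first `r`
places is zero. -/
theorem eq_zero_of_recAct_eq_zero {C : A[X]} (hC : C.Monic) {u : ℕ → A} (h : recAct C u = 0)
    {r : ℕ} (hr : C.natDegree ≤ r) (hu : ∀ i < r, u i = 0) : u = 0 := by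
  funext k
  induction k using Nat.strong_induction_on with
  | _ k ih =>
    by_cases hk : k < r
    · exact hu k hk
    · have h1 := congrFun h (k - C.natDegree)
      rw [recAct_apply, Finset.sum_range_succ, Finset.sum_eq_zero, hC.coeff_natDegree] at h1
      · rw [show k - C.natDegree + C.natDegree = k by omega] at h1
        simpa using h1
      · intro i hi
        rw [Finset.mem_range] at hi
        rw [ih _ (by omega)]
        simp

theorem recAct_eq_zero_of_isCoprime {P Q : A[X]} (h : IsCoprime P Q) {u : ℕ → A}
    (hP : recAct P u = 0) (hQ : recAct Q u = 0) : u = 0 := by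
  obtain ⟨a, b, hab⟩ := h
  rw [← recAct_one u, ← hab, recAct_add, recAct_mul_eq_zero_right hP, recAct_mul_eq_zero_right hQ,
    add_zero]

end RecAct

/-! ### Exponential polynomials and their annihilators -/

/-- On sequences `α k * l ^ k` the operator `X - l` is `l` times the forward difference of `α`, so a
power of it kills polynomial `α` of smaller degree. -/
theorem recAct_X_sub_C_pow_mul_pow (l : ℝ) (α : ℕ → ℝ) (m : ℕ) :
    recAct ((X - C l) ^ m) (fun k => α k * l ^ k) =
      fun k => l ^ m * (fwdDiff 1)^[m] α k * l ^ k := by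
  induction m with
  | zero => simp [recAct_one]
  | succ m ih =>
    rw [pow_succ', recAct_mul, ih]
    funext k
    rw [recAct_X_sub_C, Function.iterate_succ_apply', fwdDiff]
    ring

theorem recAct_X_sub_C_pow_eval_mul_pow (l : ℝ) {α : ℝ[X]} {m : ℕ} (h : α.natDegree < m) :
    recAct ((X - C l) ^ m) (fun k => α.eval (k : ℝ) * l ^ k) = 0 := by
  rw [recAct_X_sub_C_pow_mul_pow l (fun k => α.eval (k : ℝ))]
  have h1 := Polynomial.fwdDiff_iter_eq_zero_of_degree_lt h
  funext k
  have h2 : (fwdDiff 1)^[m] (fun k : ℕ => α.eval (k : ℝ)) k = (fwdDiff 1)^[m] α.eval (k : ℝ) := by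
    rw [fwdDiff_iter_eq_sum_shift, fwdDiff_iter_eq_sum_shift]
    simp
  rw [h2, h1]
  simp

/-- Exponential polynomials with two exponents: the standard killer. -/
theorem recAct_expPoly_eq_zero (l m : ℝ) {α β : ℝ[X]} {N : ℕ} (hα : α.natDegree < N)
    (hβ : β.natDegree < N) :
    recAct ((X - C l) ^ N * (X - C m) ^ N)
      (fun k => α.eval (k : ℝ) * l ^ k + β.eval (k : ℝ) * m ^ k) = 0 := by
  have : (fun k : ℕ => α.eval (k : ℝ) * l ^ k + β.eval (k : ℝ) * m ^ k) =
    (fun k : ℕ => α.eval (k : ℝ) * l ^ k) + (fun k : ℕ => β.eval (k : ℝ) * m ^ k) := rfl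
  rw [this, map_add, recAct_mul_eq_zero_left (recAct_X_sub_C_pow_eval_mul_pow l hα),
    recAct_mul_eq_zero_right (recAct_X_sub_C_pow_eval_mul_pow m hβ), add_zero]

theorem eq_zero_of_eval_natCast_eq_zero {α : ℝ[X]} (h : ∀ k : ℕ, α.eval (k : ℝ) = 0) : α = 0 := by
  apply Polynomial.eq_zero_of_infinite_isRoot
  apply Set.Infinite.mono (s := Set.range ((↑) : ℕ → ℝ))
  · rintro _ ⟨k, rfl⟩
    exact h k
  · exact Set.infinite_range_of_injective Nat.cast_injective

/-- Every killer of an exponential polynomial has the exponents as roots. -/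
theorem eval_eq_zero_of_recAct_expPoly {l m : ℝ} (hl : l ≠ 0) (hlm : l ≠ m) {α β : ℝ[X]}
    (hα : α ≠ 0) {P : ℝ[X]}
    (h : recAct P (fun k => α.eval (k : ℝ) * l ^ k + β.eval (k : ℝ) * m ^ k) = 0) :
    P.eval l = 0 := by
  by_contra hP
  set a : ℕ → ℝ := fun k : ℕ => α.eval (k : ℝ) * l ^ k with ha
  set b : ℕ → ℝ := fun k : ℕ => β.eval (k : ℝ) * m ^ k with hb
  have hab : recAct P (a + b) = 0 := h
  set M := max α.natDegree β.natDegree + 1 with hM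
  have h1 : recAct ((X - C m) ^ M) b = 0 := recAct_X_sub_C_pow_eval_mul_pow m (by omega)
  have h2 : recAct ((X - C l) ^ M) a = 0 := recAct_X_sub_C_pow_eval_mul_pow l (by omega)
  -- The factor `(X - m)^M` removes the `m`-part. If `P(l) ≠ 0`, what remains is coprime to `(X -
  -- l)^M`, which also kills `a`, and so `a = 0`.
  have h3 : recAct ((X - C m) ^ M * P) a = 0 := by
    have h4 : recAct ((X - C m) ^ M * P) (a + b) = 0 := recAct_mul_eq_zero_right hab
    rwa [map_add, recAct_mul_eq_zero_left h1, add_zero] at h4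
  have hco : IsCoprime ((X - C m) ^ M * P) ((X - C l) ^ M) := by
    apply IsCoprime.pow_right
    refine IsCoprime.mul_left (IsCoprime.pow_left ?_) ?_
    · exact isCoprime_X_sub_C_of_isUnit_sub (sub_ne_zero.2 hlm.symm).isUnit
    · rw [isCoprime_comm]
      refine (Prime.coprime_iff_not_dvd (prime_X_sub_C l)).2 ?_
      rwa [dvd_iff_isRoot]
  have h5 := recAct_eq_zero_of_isCoprime hco h3 h2
  apply hα
  apply eq_zero_of_eval_natCast_eq_zero
  intro k
  have := congrFun h5 k
  simpa [ha, hl] using this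

/-! ### Recurrences depending polynomially on a parameter -/

/-- A sequence of polynomials which at every point satisfies a linear recurrence of order at most
`r` satisfies a monic linear recurrence with polynomial coefficients. -/
theorem exists_monic_recAct_eq_zero {g : ℕ → ℝ[X]} {r : ℕ}
    (h : ∀ s : ℝ, ∃ W : ℝ[X], W.Monic ∧ W.natDegree ≤ r ∧
      recAct W (fun k => (g k).eval s) = 0) :
    ∃ P : ℝ[X][X], P.Monic ∧ recAct P g = 0 := by
  -- Windows of length `r` live in a Noetherian module, so some window is an `ℝ[X]`-combination of
  -- the earlier ones. This is a monic recurrence, so far valid only at the first `r` places.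
  set v : ℕ → Fin r → ℝ[X] := fun k i => g (k + i) with hv
  set M : ℕ →o Submodule ℝ[X] (Fin r → ℝ[X]) :=
    ⟨fun m => Submodule.span ℝ[X] (Set.range fun i : Fin m => v i), by
      intro m m' hm
      apply Submodule.span_mono
      rintro _ ⟨i, rfl⟩
      exact ⟨⟨i, lt_of_lt_of_le i.2 hm⟩, rfl⟩⟩ with hM
  obtain ⟨m, hm⟩ := monotone_stabilizes_iff_noetherian.2
    (inferInstance : IsNoetherian ℝ[X] (Fin r → ℝ[X])) M
  have hmem : v m ∈ M m := by
    rw [hm (m + 1) (Nat.le_succ m)]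
    exact Submodule.subset_span ⟨⟨m, Nat.lt_succ_self m⟩, rfl⟩
  obtain ⟨c, hc⟩ := (Submodule.mem_span_range_iff_exists_fun ℝ[X]).1 hmem
  set Q : ℝ[X][X] := ∑ i : Fin m, C (c i) * X ^ (i : ℕ) with hQ
  have hQdeg : Q.degree < m := by
    apply degree_sum_fin_lt
  have hmon : (X ^ m - Q).Monic := monic_X_pow_sub hQdeg
  refine ⟨X ^ m - Q, hmon, ?_⟩
  have hfirst : ∀ j < r, recAct (X ^ m - Q) g j = 0 := by
    intro j hj
    have h1 := congrFun hc ⟨j, hj⟩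
    rw [recAct_sub, Pi.sub_apply, sub_eq_zero]
    have h2 : recAct (X ^ m : ℝ[X][X]) g j = g (j + m) := by
      rw [recAct, map_pow, aeval_X, seqShift_pow_apply]
    rw [h2, hQ, recAct, map_sum, LinearMap.sum_apply, Finset.sum_apply]
    rw [Finset.sum_apply] at h1
    rw [add_comm j m]
    change _ = g (m + j) at h1
    rw [← h1]
    refine Finset.sum_congr rfl fun i _ => ?_
    rw [map_mul, map_pow, aeval_X, aeval_C, Module.End.mul_apply, Module.algebraMap_end_apply,
      Pi.smul_apply, Pi.smul_apply, seqShift_pow_apply, hv]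
    simp only [add_comm]
  funext j
  apply Polynomial.funext
  intro s
  obtain ⟨W, hW, hWr, hW0⟩ := h s
  -- At each `s` the defect of the new recurrence is still killed by `W`, of order at most `r`, and
  -- its first `r` terms vanish; so it is zero.
  have key : recAct ((X ^ m - Q).map (evalRingHom s)) (fun k => evalRingHom s (g k)) = 0 := by
    apply eq_zero_of_recAct_eq_zero hW _ hWr
    · intro i hi
      rw [map_recAct, hfirst i hi, map_zero]
    · rw [← recAct_mul, mul_comm, recAct_mul]
      simp only [coe_evalRingHom]
      rw [hW0, map_zero]
  have := congrFun key j
  rw [map_recAct] at this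
  simpa using this

/-- The annihilator ideal of a sequence. -/
noncomputable def recAnn {A : Type*} [CommRing A] (u : ℕ → A) : Ideal A[X] where
  carrier := {P | recAct P u = 0}
  add_mem' {P Q} hP hQ := by
    simp only [mem_ofPred_eq] at hP hQ ⊢
    rw [recAct_add, hP, hQ, add_zero]
  zero_mem' := by simp [recAct]
  smul_mem' P Q hQ := recAct_mul_eq_zero_right hQ

theorem mem_recAnn {A : Type*} [CommRing A] {u : ℕ → A} {P : A[X]} :
    P ∈ recAnn u ↔ recAct P u = 0 := Iff.rfl

theorem recAct_map_algebraMap_eq_zero_iff {g : ℕ → ℝ[X]} {Q : ℝ[X][X]} :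
    recAct (Q.map (algebraMap ℝ[X] (FractionRing ℝ[X])))
      (fun k => algebraMap ℝ[X] (FractionRing ℝ[X]) (g k)) = 0 ↔ recAct Q g = 0 := by
  constructor
  · intro h
    funext k
    have := congrFun h k
    rw [map_recAct] at this
    exact (IsFractionRing.injective ℝ[X] (FractionRing ℝ[X])) (by simpa using this)
  · intro h
    funext k
    rw [map_recAct, h]
    simp

/-- The minimal recurrence of a sequence of polynomials satisfying some monic recurrence has
polynomial coefficients, and the Hankel determinant of its order does not vanish. -/
theorem exists_minimal_monic {g : ℕ → ℝ[X]} {P : ℝ[X][X]} (hP : P.Monic)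
    (hPg : recAct P g = 0) :
    ∃ Q : ℝ[X][X], Q.Monic ∧ recAct Q g = 0 ∧
      (Matrix.of fun i j : Fin Q.natDegree => g (i + j)).det ≠ 0 := by
  set K := FractionRing ℝ[X]
  set φ := algebraMap ℝ[X] K
  have hφ : Function.Injective φ := IsFractionRing.injective ℝ[X] K
  set u : ℕ → K := fun k => φ (g k) with hu
  have hPu : P.map φ ∈ recAnn u := recAct_map_algebraMap_eq_zero_iff.2 hPg
  set G := Submodule.IsPrincipal.generator (recAnn u)
  have hGdvd : ∀ D ∈ recAnn u, G ∣ D := fun D hD =>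
    (Submodule.IsPrincipal.mem_iff_generator_dvd _).1 hD
  have hG0 : G ≠ 0 := by
    intro h
    have := hGdvd _ hPu
    rw [h, zero_dvd_iff] at this
    exact (hP.map φ).ne_zero this
  -- Gauss's lemma: a divisor over the fraction field of a monic polynomial over `ℝ[X]` has, once
  -- normalised, coefficients in `ℝ[X]`.
  obtain ⟨Q, hQ⟩ := IsIntegrallyClosed.eq_map_mul_C_of_dvd K hP (hGdvd _ hPu)
  have hlead : G.leadingCoeff ≠ 0 := leadingCoeff_ne_zero.2 hG0
  have hQmap : Q.map φ = G * C G.leadingCoeff⁻¹ := by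
    rw [← hQ, mul_assoc, ← C_mul, leadingCoeff_mul, leadingCoeff_C, mul_inv]
    have h2 : (Q.map φ).leadingCoeff = 1 := by
      have := congrArg leadingCoeff hQ
      rw [leadingCoeff_mul, leadingCoeff_C] at this
      exact mul_right_cancel₀ hlead (by simpa using this)
    rw [h2, inv_one, one_mul, mul_inv_cancel₀ hlead, C_1, mul_one]
  have hQm : Q.Monic := by
    refine Polynomial.monic_of_injective hφ ?_
    rw [hQmap]
    exact monic_mul_leadingCoeff_inv hG0
  have hQu : recAct (Q.map φ) u = 0 := by
    rw [hQmap]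
    exact recAct_mul_eq_zero_left (mem_recAnn.1 (Submodule.IsPrincipal.generator_mem (recAnn u)))
  refine ⟨Q, hQm, recAct_map_algebraMap_eq_zero_iff.1 hQu, ?_⟩
  intro hdet
  have hdet' : (Matrix.of fun i j : Fin Q.natDegree => u (i + j)).det = 0 := by
    have := congrArg φ hdet
    rw [RingHom.map_det, map_zero] at this
    rw [← this]
    rfl
  -- A kernel vector is the coefficient vector of some `B` of degree below `Q` whose action on `u`
  -- vanishes at the first `Q.natDegree` places. That action is also killed by `Q`, so `B`
  -- annihilates `u`, against minimality.
  obtain ⟨v, hv0, hv⟩ := Matrix.exists_mulVec_eq_zero_iff.2 hdet'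
  set B : K[X] := ∑ i : Fin Q.natDegree, C (v i) * X ^ (i : ℕ) with hB
  have hBdeg : B.degree < Q.natDegree := degree_sum_fin_lt v
  have hBu : recAct B u = 0 := by
    refine eq_zero_of_recAct_eq_zero (hQm.map φ) (r := Q.natDegree) ?_ natDegree_map_le ?_
    · rw [← recAct_mul, mul_comm, recAct_mul, hQu, map_zero]
    · intro j hj
      have h1 := congrFun hv ⟨j, hj⟩
      rw [Matrix.mulVec, dotProduct] at h1
      rw [hB, recAct, map_sum, LinearMap.sum_apply, Finset.sum_apply]
      rw [Pi.zero_apply] at h1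
      rw [← h1]
      refine Finset.sum_congr rfl fun i _ => ?_
      rw [map_mul, map_pow, aeval_X, aeval_C, Module.End.mul_apply, Module.algebraMap_end_apply,
        Pi.smul_apply, seqShift_pow_apply, Matrix.of_apply, smul_eq_mul]
      exact mul_comm (v i) (u (j + i))
  have hB0 : B = 0 := by
    by_contra hne
    have hdvd : Q.map φ ∣ B := by
      rw [hQmap]
      have : IsUnit (C G.leadingCoeff⁻¹) := isUnit_C.2 (inv_ne_zero hlead).isUnit
      exact (this.mul_right_dvd).2 (hGdvd _ hBu)
    have := degree_le_of_dvd hdvd hne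
    rw [(hQm.degree_map φ), degree_eq_natDegree hQm.ne_zero] at this
    exact absurd hBdeg (not_lt.2 this)
  apply hv0
  funext i
  have := congrArg (fun p => p.coeff (i : ℕ)) hB0
  simp only [hB, finsetSum_coeff, coeff_C_mul, coeff_X_pow, coeff_zero, mul_ite, mul_one,
    mul_zero, Fin.val_inj] at this
  simpa using this

/-- A monic recurrence of order `r` of a sequence whose Hankel determinant of size `r` does not
vanish divides every other recurrence. -/
theorem dvd_of_hankel_det_ne_zero {F : Type*} [Field F] {u : ℕ → F} {Q W : F[X]} (hQ : Q.Monic)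
    (hQu : recAct Q u = 0) (hWu : recAct W u = 0)
    (hdet : (Matrix.of fun i j : Fin Q.natDegree => u (i + j)).det ≠ 0) : Q ∣ W := by
  rw [← modByMonic_eq_zero_iff_dvd hQ]
  by_cases hQ1 : Q = 1
  · rw [hQ1, modByMonic_one]
  set B := W %ₘ Q with hB
  have hBdeg : B.natDegree < Q.natDegree := natDegree_modByMonic_lt W hQ hQ1
  have hBu : recAct B u = 0 := by
    rw [hB, modByMonic_eq_sub_mul_div, recAct_sub, hWu, recAct_mul_eq_zero_left hQu, sub_zero]
  -- The remainder of `W` modulo `Q` annihilates `u` as well, so its coefficients form a kernel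
  -- vector of the Hankel matrix.
  have hv : (Matrix.of fun i j : Fin Q.natDegree => u (i + j)).mulVec (fun i => B.coeff i) = 0 := by
    funext j
    have := congrFun hBu j
    rw [recAct_apply_of_natDegree_lt hBdeg, ← Fin.sum_univ_eq_sum_range
      (fun i => B.coeff i * u (j + i))] at this
    rw [Matrix.mulVec, dotProduct]
    exact (Finset.sum_congr rfl fun i _ => mul_comm _ _).trans this
  have h0 := Matrix.eq_zero_of_mulVec_eq_zero hdet hv
  ext i
  by_cases hi : i < Q.natDegree
  · exact congrFun h0 ⟨i, hi⟩
  · rw [coeff_eq_zero_of_natDegree_lt (by omega), coeff_zero]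

/-! ### Power sums of the exponents -/

/-- A monic divisor of `(X - l)^N (X - m)^N` is `(X - l)^p (X - m)^q`. -/
theorem eq_pow_mul_pow_of_dvd {l m : ℝ} {N : ℕ} {Q : ℝ[X]} (hQ : Q.Monic)
    (h : Q ∣ (X - C l) ^ N * (X - C m) ^ N) :
    ∃ p q : ℕ, Q = (X - C l) ^ p * (X - C m) ^ q := by
  obtain ⟨a, b, ha, hb, rfl⟩ := exists_dvd_and_dvd_of_dvd_mul h
  obtain ⟨p, -, hp⟩ := (dvd_prime_pow (prime_X_sub_C l) N).1 ha
  obtain ⟨q, -, hq⟩ := (dvd_prime_pow (prime_X_sub_C m) N).1 hb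
  refine ⟨p, q, eq_of_monic_of_associated hQ ?_ (hp.mul_mul hq)⟩
  exact ((monic_X_sub_C l).pow p).mul ((monic_X_sub_C m).pow q)

/-- For `P = ∏ (1 - r X)` the quantities `-P.coeff 1` and `P.coeff 1 ^ 2 - 2 * P.coeff 2` are the
first two power sums of the `r`, hence additive under multiplication. This replaces Newton's
identities; a monic polynomial is brought to this form by reversing it. -/
theorem coeff_one_two_mul {P Q : ℝ[X]} (hP : P.coeff 0 = 1) (hQ : Q.coeff 0 = 1) :
    (P * Q).coeff 0 = 1 ∧ (P * Q).coeff 1 = P.coeff 1 + Q.coeff 1 ∧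
      (P * Q).coeff 1 ^ 2 - 2 * (P * Q).coeff 2 =
        (P.coeff 1 ^ 2 - 2 * P.coeff 2) + (Q.coeff 1 ^ 2 - 2 * Q.coeff 2) := by
  have h0 : (P * Q).coeff 0 = 1 := by rw [mul_coeff_zero, hP, hQ, one_mul]
  have h1 : (P * Q).coeff 1 = P.coeff 1 + Q.coeff 1 := by
    rw [coeff_mul, Finset.Nat.sum_antidiagonal_succ]
    simp [hP, hQ, add_comm]
  have h2 : (P * Q).coeff 2 = P.coeff 2 + P.coeff 1 * Q.coeff 1 + Q.coeff 2 := by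
    rw [coeff_mul, Finset.Nat.sum_antidiagonal_succ, Finset.Nat.sum_antidiagonal_succ]
    simp [hP, hQ]
    ring
  refine ⟨h0, h1, ?_⟩
  rw [h1, h2]
  ring

theorem coeff_one_two_pow (l : ℝ) (p : ℕ) :
    ((1 - C l * X) ^ p : ℝ[X]).coeff 0 = 1 ∧ ((1 - C l * X) ^ p : ℝ[X]).coeff 1 = -(p * l) ∧
      ((1 - C l * X) ^ p : ℝ[X]).coeff 1 ^ 2 - 2 * ((1 - C l * X) ^ p : ℝ[X]).coeff 2 =
        p * l ^ 2 := by
  have e0 : (1 - C l * X : ℝ[X]).coeff 0 = 1 := by simp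
  have e1 : (1 - C l * X : ℝ[X]).coeff 1 = -l := by simp [coeff_one]
  have e2 : (1 - C l * X : ℝ[X]).coeff 2 = 0 := by simp [coeff_one]
  induction p with
  | zero => simp [coeff_one]
  | succ p ih =>
    obtain ⟨h0, h1, h2⟩ := ih
    obtain ⟨k0, k1, k2⟩ := coeff_one_two_mul h0 e0
    rw [← pow_succ] at k0 k1 k2
    refine ⟨k0, ?_, ?_⟩
    · rw [k1, h1, e1]; push_cast; ring
    · rw [k2, h2, e1, e2]; push_cast; ring

theorem reverse_X_sub_C_pow (l : ℝ) (p : ℕ) :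
    ((X - C l) ^ p : ℝ[X]).reverse = (1 - C l * X) ^ p := by
  induction p with
  | zero => simpa using reverse_C (1 : ℝ)
  | succ p ih =>
    rw [pow_succ, reverse_mul_of_domain, ih, pow_succ]
    congr 1
    ext i
    rw [coeff_reverse, natDegree_X_sub_C]
    rcases i with _ | _ | i
    · simp [revAt_le]
    · simp [revAt_le, coeff_one]
    · rw [revAt_eq_self_of_lt (by omega)]
      simp [coeff_X, coeff_one]

/-- The first two power sums of the roots (with multiplicities) in terms of the coefficients. -/
theorem powerSums_of_eq_pow_mul_pow {l m : ℝ} {p q : ℕ} (hpq : 2 ≤ p + q) {Q : ℝ[X]}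
    (h : Q = (X - C l) ^ p * (X - C m) ^ q) :
    p * l + q * m = - Q.coeff (p + q - 1) ∧
      p * l ^ 2 + q * m ^ 2 = Q.coeff (p + q - 1) ^ 2 - 2 * Q.coeff (p + q - 2) := by
  have hdeg : Q.natDegree = p + q := by
    rw [h, Monic.natDegree_mul ((monic_X_sub_C l).pow p) ((monic_X_sub_C m).pow q)]
    simp
  have hrev : Q.reverse = (1 - C l * X) ^ p * (1 - C m * X) ^ q := by
    rw [h, reverse_mul_of_domain, reverse_X_sub_C_pow, reverse_X_sub_C_pow]
  obtain ⟨a0, a1, a2⟩ := coeff_one_two_pow l p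
  obtain ⟨b0, b1, b2⟩ := coeff_one_two_pow m q
  obtain ⟨-, k1, k2⟩ := coeff_one_two_mul a0 b0
  rw [← hrev, coeff_reverse, hdeg, revAt_le (by omega)] at k1 k2
  rw [coeff_reverse, hdeg, revAt_le (by omega)] at k2
  constructor
  · rw [k1, a1, b1]; ring
  · rw [k2, a2, b2]

/-- If a sequence of polynomials is at each point an exponential polynomial with the two exponents
`l s` and `m s`, then the first two power sums of the exponents, with multiplicities, are
polynomials in the parameter. -/
theorem exists_powerSums {g : ℕ → ℝ[X]} {l m : ℝ → ℝ} {N : ℕ}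
    (h : ∀ s, l s ≠ 0 ∧ m s ≠ 0 ∧ l s ≠ m s ∧ ∃ α β : ℝ[X], α ≠ 0 ∧ β ≠ 0 ∧ α.natDegree < N ∧
      β.natDegree < N ∧ ∀ k, (g k).eval s = α.eval (k : ℝ) * l s ^ k + β.eval (k : ℝ) * m s ^ k) :
    ∃ (r : ℕ) (c₁ c₂ H : ℝ[X]), H ≠ 0 ∧ ∀ s, H.eval s ≠ 0 → ∃ p q : ℕ, 0 < p ∧ 0 < q ∧ p + q = r ∧
      p * l s + q * m s = c₁.eval s ∧ p * l s ^ 2 + q * m s ^ 2 = c₂.eval s := by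
  have hW : ∀ s, recAct ((X - C (l s)) ^ N * (X - C (m s)) ^ N) (fun k => (g k).eval s) = 0 := by
    intro s
    obtain ⟨-, -, -, α, β, -, -, hα, hβ, hg⟩ := h s
    rw [funext hg]
    exact recAct_expPoly_eq_zero _ _ hα hβ
  obtain ⟨P, hP, hPg⟩ := exists_monic_recAct_eq_zero (g := g) (r := N + N) (fun s =>
    ⟨_, ((monic_X_sub_C (l s)).pow N).mul ((monic_X_sub_C (m s)).pow N), by
      rw [Monic.natDegree_mul ((monic_X_sub_C _).pow N) ((monic_X_sub_C _).pow N)]; simp, hW s⟩)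
  obtain ⟨Q, hQ, hQg, hdet⟩ := exists_minimal_monic hP hPg
  refine ⟨Q.natDegree, - Q.coeff (Q.natDegree - 1),
    Q.coeff (Q.natDegree - 1) ^ 2 - 2 * Q.coeff (Q.natDegree - 2), _, hdet, ?_⟩
  intro s hs
  set Qs : ℝ[X] := Q.map (evalRingHom s) with hQs
  have hQsm : Qs.Monic := hQ.map _
  have hQsdeg : Qs.natDegree = Q.natDegree := hQ.natDegree_map _
  have hQsg : recAct Qs (fun k => (g k).eval s) = 0 := by
    funext k
    have := map_recAct (evalRingHom s) Q g k
    rw [hQg] at this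
    simpa using this
  obtain ⟨hl, hm, hlm, α, β, hα0, hβ0, hα, hβ, hg⟩ := h s
  -- Where the Hankel determinant does not vanish the specialised recurrence stays minimal, so it
  -- divides the two-exponent annihilator at `s`.
  have hdvd := dvd_of_hankel_det_ne_zero hQsm hQsg (hW s) (by
    rw [hQsdeg]
    intro h0
    apply hs
    rw [← coe_evalRingHom, RingHom.map_det, ← h0]
    rfl)
  obtain ⟨p, q, hpq⟩ := eq_pow_mul_pow_of_dvd hQsm hdvd
  have hdegpq : Q.natDegree = p + q := by
    rw [← hQsdeg, hpq, Monic.natDegree_mul ((monic_X_sub_C _).pow p) ((monic_X_sub_C _).pow q)]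
    simp
  rw [funext hg] at hQsg
  have hp : 0 < p := by
    rcases Nat.eq_zero_or_pos p with rfl | hp
    · have := eval_eq_zero_of_recAct_expPoly hl hlm hα0 hQsg
      rw [hpq] at this
      simp only [pow_zero, one_mul, eval_pow, eval_sub, eval_X, eval_C] at this
      exact absurd (eq_zero_of_pow_eq_zero this) (sub_ne_zero.2 hlm)
    · exact hp
  have hq : 0 < q := by
    rcases Nat.eq_zero_or_pos q with rfl | hq
    · have := eval_eq_zero_of_recAct_expPoly (α := β) (β := α) hm hlm.symm hβ0 (P := Qs) (by
        rw [← hQsg]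
        congr 1
        funext k
        ring)
      rw [hpq] at this
      simp only [pow_zero, mul_one, eval_pow, eval_sub, eval_X, eval_C] at this
      exact absurd (eq_zero_of_pow_eq_zero this) (sub_ne_zero.2 hlm.symm)
    · exact hq
  obtain ⟨k1, k2⟩ := powerSums_of_eq_pow_mul_pow (by omega) hpq
  refine ⟨p, q, hp, hq, hdegpq.symm, ?_, ?_⟩
  · rw [k1, hQs, coeff_map, ← hdegpq]
    simp
  · rw [k2, hQs, coeff_map, coeff_map, ← hdegpq]
    simp

/-! ### Two exponents along a line: constancy and equality of multiplicities -/

theorem natDegree_le_of_abs_eval_le {c : ℝ[X]} {K : ℝ} {d : ℕ}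
    (h : ∀ s : ℝ, 1 ≤ s → |c.eval s| ≤ K * s ^ d) : c.natDegree ≤ d := by
  by_contra hd
  push Not at hd
  have hdeg : (X ^ d : ℝ[X]).degree < c.degree := by
    rw [degree_X_pow]
    rw [degree_eq_natDegree (by rintro rfl; simp at hd)]
    exact_mod_cast hd
  have h1 := abs_div_tendsto_atTop_atTop_of_degree_gt c (X ^ d) hdeg (pow_ne_zero d X_ne_zero)
  obtain ⟨s, hs1, hs2⟩ := ((h1.eventually_gt_atTop K).and (eventually_ge_atTop (1 : ℝ))).exists
  have hpos : (0 : ℝ) < s ^ d := by positivity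
  rw [eval_pow, eval_X, abs_div, abs_of_pos hpos, lt_div_iff₀ hpos] at hs1
  exact absurd (h s hs2) (not_le.2 hs1)

theorem eval_eq_of_natDegree_le_one {c : ℝ[X]} (h : c.natDegree ≤ 1) (s : ℝ) :
    c.eval s = c.coeff 0 + c.coeff 1 * s := by
  rw [eval_eq_sum_range' (Nat.lt_succ_of_le h)]
  simp [Finset.sum_range_succ]

/-- A continuous function on the line which takes finitely many values on a dense set is
constant. -/
theorem exists_eq_of_dense_of_finite {f : ℝ → ℝ} (hf : Continuous f) {S F : Set ℝ} (hS : Dense S)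
    (hF : F.Finite) (h : ∀ s ∈ S, f s ∈ F) : ∃ a ∈ F, ∀ s, f s = a := by
  have hall : ∀ s, f s ∈ F := by
    have : closure S ⊆ f ⁻¹' F := closure_minimal h (hF.isClosed.preimage hf)
    intro s
    exact this (hS s)
  refine ⟨f 0, hall 0, fun s => ?_⟩
  exact isPreconnected_univ.constant_of_mapsTo hF.isDiscrete hf.continuousOn (T := F) (fun s _ => hall s)
    (mem_univ s) (mem_univ 0)

theorem dense_eval_ne_zero {H : ℝ[X]} (hH : H ≠ 0) : Dense {s : ℝ | H.eval s ≠ 0} := by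
  have : ({s : ℝ | H.eval s = 0}).Finite := by
    refine (H.rootSet_finite ℝ).subset ?_
    intro s hs
    rw [mem_rootSet]
    exact ⟨hH, by simpa using hs⟩
  exact this.countable.dense_compl ℝ

/-- The multiplicity `p` can be read off continuously from the first power sum, so it does not
depend on `s`. The exchange of `L` and `M` at `-∞` forces `p = q`, and then the power sums give `l +
m` and `l² + m²`; their degrees are bounded by growth at `+∞`. -/
theorem two_exponents_on_line {l m : ℝ → ℝ} (hl : Continuous l) (hm : Continuous m)
    (hlm : ∀ s, l s ≠ m s) {L M K : ℝ} (hLM : L ≠ M)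
    (hlp : ∀ s, 0 ≤ s → |l s - s * L| ≤ K) (hmp : ∀ s, 0 ≤ s → |m s - s * M| ≤ K)
    (hln : ∀ s, s ≤ 0 → |l s - s * M| ≤ K) (hmn : ∀ s, s ≤ 0 → |m s - s * L| ≤ K)
    {r : ℕ} {c₁ c₂ H : ℝ[X]} (hH : H ≠ 0)
    (h : ∀ s, H.eval s ≠ 0 → ∃ p q : ℕ, 0 < p ∧ 0 < q ∧ p + q = r ∧
      p * l s + q * m s = c₁.eval s ∧ p * l s ^ 2 + q * m s ^ 2 = c₂.eval s) :
    (∃ e, ∀ s, l s + m s = e + s * (L + M)) ∧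
      ∃ A B, ∀ s, (l s - m s) ^ 2 = A + B * s + (L - M) ^ 2 * s ^ 2 := by
  have hK : 0 ≤ K := (abs_nonneg _).trans (hlp 0 le_rfl)
  have hdense := dense_eval_ne_zero hH
  -- This quotient is `p`, obtained by solving `p * l + (r - p) * m = c₁`.
  obtain ⟨P, hPF, hP⟩ := exists_eq_of_dense_of_finite
    (f := fun s => (c₁.eval s - r * m s) / (l s - m s))
    ((c₁.continuous.sub (continuous_const.mul hm)).div (hl.sub hm) fun s => sub_ne_zero.2 (hlm s))
    hdense (F := (fun k : ℕ => (k : ℝ)) '' {k | 0 < k ∧ k ≤ r})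
    (((Set.finite_Iic r).subset fun k hk => hk.2).image _) (by
      intro s hs
      obtain ⟨p, q, hp, hq, hpq, h1, -⟩ := h s hs
      refine ⟨p, ⟨hp, by omega⟩, ?_⟩
      simp only
      rw [eq_div_iff (sub_ne_zero.2 (hlm s)), ← h1, ← hpq]
      push_cast
      ring)
  obtain ⟨p, ⟨hp0, hpr⟩, rfl⟩ := hPF
  simp only at hP
  set q : ℝ := r - p with hq
  have hp0' : (0 : ℝ) < p := by exact_mod_cast hp0
  have hq0 : 0 ≤ q := by
    rw [hq, sub_nonneg]
    exact_mod_cast hpr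
  have e1 : ∀ s, p * l s + q * m s = c₁.eval s := by
    intro s
    have := hP s
    rw [div_eq_iff (sub_ne_zero.2 (hlm s))] at this
    rw [hq]
    linarith
  have e2 : ∀ s, p * l s ^ 2 + q * m s ^ 2 = c₂.eval s := by
    have hcont1 : Continuous fun s => p * l s ^ 2 + q * m s ^ 2 := by fun_prop
    have := Continuous.ext_on hdense hcont1 c₂.continuous (by
      intro s hs
      obtain ⟨p', q', -, -, hpq, h1, h2⟩ := h s hs
      have hp' : (p' : ℝ) = p := by
        have := e1 s
        have hr : (r : ℝ) = p' + q' := by rw [← hpq]; push_cast; ring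
        have : ((p' : ℝ) - p) * (l s - m s) = 0 := by
          rw [← h1, hq, hr] at this
          linarith
        rcases mul_eq_zero.1 this with h0 | h0
        · linarith
        · exact absurd h0 (sub_ne_zero.2 (hlm s))
      have hq' : (q' : ℝ) = q := by rw [hq, ← hpq, ← hp']; push_cast; ring
      simp only
      rw [← h2, hp', hq'])
    exact fun s => congrFun this s
  have bound : ∀ (s a b u v : ℝ), |u - s * a| ≤ K → |v - s * b| ≤ K →
      |(p * u + q * v) - s * (p * a + q * b)| ≤ (p + q) * K := by
    intro s a b u v hu hv
    have : (p * u + q * v) - s * (p * a + q * b) = p * (u - s * a) + q * (v - s * b) := by ring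
    rw [this]
    refine (abs_add_le _ _).trans ?_
    rw [abs_mul, abs_mul, abs_of_pos hp0', abs_of_nonneg hq0, add_mul]
    gcongr
  have hc1 : (c₁ - C (p * L + q * M) * X).natDegree ≤ 0 := by
    apply natDegree_le_of_abs_eval_le (K := (p + q) * K)
    intro s hs
    have := bound s L M _ _ (hlp s (by linarith)) (hmp s (by linarith))
    rw [e1] at this
    simpa [mul_comm] using this
  obtain ⟨e, he⟩ : ∃ e, ∀ s, c₁.eval s = e + s * (p * L + q * M) := by
    rw [natDegree_le_iff_degree_le] at hc1
    obtain ⟨e, he⟩ : ∃ e, c₁ - C (p * L + q * M) * X = C e := ⟨_, eq_C_of_degree_le_zero hc1⟩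
    refine ⟨e, fun s => ?_⟩
    have := congrArg (eval s) he
    simp only [eval_sub, eval_mul, eval_C, eval_X] at this
    linarith
  -- The slope of `c₁` is `p L + q M` seen from `+∞` and `p M + q L` seen from `-∞`, and `L ≠ M`.
  have hpq : (p : ℝ) = q := by
    have h2 : (C e + C ((p * M + q * L) - (p * L + q * M)) * X).natDegree ≤ 0 := by
      apply natDegree_le_of_abs_eval_le (K := (p + q) * K)
      intro s hs
      have := bound (-s) M L _ _ (hln (-s) (by linarith)) (hmn (-s) (by linarith))
      rw [e1, he] at this
      simp only [eval_add, eval_C, eval_mul, eval_X, pow_zero, mul_one]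
      convert this using 2
      ring
    have h3 : (C e + C ((p * M + q * L) - (p * L + q * M)) * X).coeff 1 = 0 :=
      coeff_eq_zero_of_natDegree_lt (by omega)
    simp only [coeff_add, coeff_C_mul, coeff_X_one, mul_one, coeff_C_succ, zero_add] at h3
    have h4 : ((p : ℝ) - q) * (L - M) = 0 := by linarith
    rcases mul_eq_zero.1 h4 with h0 | h0
    · linarith
    · exact absurd h0 (sub_ne_zero.2 hLM)
  rw [← hpq] at e1 e2 he
  have eS : ∀ s, l s + m s = e / p + s * (L + M) := by
    intro s
    have := e1 s
    rw [he] at this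
    field_simp
    linarith
  refine ⟨⟨_, eS⟩, ?_⟩
  -- The identity is `(l - m)² = 2 (l² + m²) - (l + m)²`.
  set c : ℝ[X] := C (2 / (p : ℝ)) * c₂ - (C (1 / (p : ℝ)) * c₁) ^ 2 with hc
  have ec : ∀ s, (l s - m s) ^ 2 = c.eval s := by
    intro s
    simp only [hc, eval_sub, eval_mul, eval_C, eval_pow]
    rw [← e1, ← e2]
    field_simp
    ring
  -- As a difference of squares this is a bounded factor times one of linear growth, which fixes the
  -- leading coefficient.
  have hcdeg : (c - C ((L - M) ^ 2) * X ^ 2).natDegree ≤ 1 := by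
    apply natDegree_le_of_abs_eval_le (K := 2 * K * (2 * |L - M| + 2 * K))
    intro s hs
    have h1 := hlp s (by linarith)
    have h2 := hmp s (by linarith)
    have h3 : |(l s - m s) - s * (L - M)| ≤ 2 * K := by
      have : (l s - m s) - s * (L - M) = (l s - s * L) - (m s - s * M) := by ring
      rw [this]
      refine (abs_sub _ _).trans ?_
      linarith
    have h4 : |(l s - m s) + s * (L - M)| ≤ (2 * |L - M| + 2 * K) * s := by
      have : (l s - m s) + s * (L - M) = ((l s - m s) - s * (L - M)) + 2 * s * (L - M) := by ring
      rw [this]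
      refine (abs_add_le _ _).trans ?_
      rw [abs_mul, abs_of_nonneg (by linarith : 0 ≤ 2 * s)]
      nlinarith
    simp only [eval_sub, eval_mul, eval_C, eval_pow, eval_X, pow_one]
    rw [← ec]
    have : (l s - m s) ^ 2 - (L - M) ^ 2 * s ^ 2 =
      ((l s - m s) - s * (L - M)) * ((l s - m s) + s * (L - M)) := by ring
    rw [this, abs_mul, mul_assoc]
    exact mul_le_mul h3 h4 (abs_nonneg _) (by linarith)
  refine ⟨(c - C ((L - M) ^ 2) * X ^ 2).coeff 0, (c - C ((L - M) ^ 2) * X ^ 2).coeff 1,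
    fun s => ?_⟩
  rw [ec, ← eval_eq_of_natDegree_le_one hcdeg]
  simp

/-! ### Support functions -/

section Support

variable {n : ℕ} {D : Set (EuclideanSpace ℝ (Fin n))}

theorem image_inner_bddAbove (hD : Bornology.IsBounded D) (ξ : EuclideanSpace ℝ (Fin n)) :
    BddAbove ((fun x => inner ℝ ξ x) '' D) :=
  (((innerSL ℝ ξ).lipschitz.isBounded_image hD).bddAbove)

theorem image_inner_bddBelow (hD : Bornology.IsBounded D) (ξ : EuclideanSpace ℝ (Fin n)) :
    BddBelow ((fun x => inner ℝ ξ x) '' D) :=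
  (((innerSL ℝ ξ).lipschitz.isBounded_image hD).bddBelow)

theorem inner_le_upperSupport (hD : Bornology.IsBounded D) {x : EuclideanSpace ℝ (Fin n)}
    (hx : x ∈ D) (ξ : EuclideanSpace ℝ (Fin n)) : inner ℝ ξ x ≤ upperSupport D ξ :=
  le_csSup (image_inner_bddAbove hD ξ) (mem_image_of_mem _ hx)

theorem upperSupport_le (hne : D.Nonempty) {ξ : EuclideanSpace ℝ (Fin n)} {a : ℝ}
    (h : ∀ x ∈ D, inner ℝ ξ x ≤ a) : upperSupport D ξ ≤ a := by
  apply csSup_le (hne.image _)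
  rintro _ ⟨x, hx, rfl⟩
  exact h x hx

theorem upperSupport_neg (ξ : EuclideanSpace ℝ (Fin n)) :
    upperSupport D (-ξ) = - lowerSupport D ξ := by
  rw [upperSupport, lowerSupport, Real.sInf_def, neg_neg]
  congr 1
  ext t
  simp [neg_eq_iff_eq_neg]

theorem lowerSupport_neg (ξ : EuclideanSpace ℝ (Fin n)) :
    lowerSupport D (-ξ) = - upperSupport D ξ := by
  have := upperSupport_neg (D := D) (-ξ)
  rw [neg_neg] at this
  rw [this, neg_neg]

theorem upperSupport_smul {t : ℝ} (ht : 0 ≤ t) (ξ : EuclideanSpace ℝ (Fin n)) :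
    upperSupport D (t • ξ) = t * upperSupport D ξ := by
  rw [upperSupport, upperSupport, ← smul_eq_mul, ← Real.sSup_smul_of_nonneg ht, ← image_smul,
    image_image]
  simp [inner_smul_left]

theorem lowerSupport_smul {t : ℝ} (ht : 0 ≤ t) (ξ : EuclideanSpace ℝ (Fin n)) :
    lowerSupport D (t • ξ) = t * lowerSupport D ξ := by
  have := upperSupport_smul (D := D) ht (-ξ)
  rw [smul_neg, upperSupport_neg, upperSupport_neg] at this
  linarith

theorem exists_inner_add_lt (hD : IsOpen D) {x : EuclideanSpace ℝ (Fin n)} (hx : x ∈ D)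
    {ξ : EuclideanSpace ℝ (Fin n)} (hξ : ξ ≠ 0) : ∃ y ∈ D, inner ℝ ξ x < inner ℝ ξ y := by
  have hc : Continuous fun t : ℝ => x + t • ξ := by fun_prop
  have h0 : ∀ᶠ t in 𝓝 (0 : ℝ), x + t • ξ ∈ D :=
    hc.continuousAt.eventually_mem (hD.mem_nhds (by simpa using hx))
  have h1 : ∀ᶠ t in 𝓝[>] (0 : ℝ), x + t • ξ ∈ D := h0.filter_mono nhdsWithin_le_nhds
  obtain ⟨t, ht, ht0⟩ := (h1.and self_mem_nhdsWithin).exists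
  refine ⟨_, ht, ?_⟩
  rw [inner_add_right, inner_smul_right, real_inner_self_eq_norm_sq]
  have : 0 < t * ‖ξ‖ ^ 2 := mul_pos ht0 (by positivity)
  linarith

theorem inner_lt_upperSupport (hD : IsOpen D) (hb : Bornology.IsBounded D)
    {x : EuclideanSpace ℝ (Fin n)} (hx : x ∈ D) {ξ : EuclideanSpace ℝ (Fin n)} (hξ : ξ ≠ 0) :
    inner ℝ ξ x < upperSupport D ξ := by
  obtain ⟨y, hy, hxy⟩ := exists_inner_add_lt hD hx hξ
  exact hxy.trans_le (inner_le_upperSupport hb hy ξ)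

theorem lowerSupport_lt_inner (hD : IsOpen D) (hb : Bornology.IsBounded D)
    {x : EuclideanSpace ℝ (Fin n)} (hx : x ∈ D) {ξ : EuclideanSpace ℝ (Fin n)} (hξ : ξ ≠ 0) :
    lowerSupport D ξ < inner ℝ ξ x := by
  have := inner_lt_upperSupport hD hb hx (neg_ne_zero.2 hξ)
  rw [upperSupport_neg, inner_neg_left] at this
  linarith

theorem upperSupport_sub_le (hne : D.Nonempty) (hb : Bornology.IsBounded D) {R : ℝ}
    (hR : ∀ x ∈ D, ‖x‖ ≤ R) (ξ η : EuclideanSpace ℝ (Fin n)) :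
    |upperSupport D ξ - upperSupport D η| ≤ R * ‖ξ - η‖ := by
  have key : ∀ ξ η : EuclideanSpace ℝ (Fin n),
      upperSupport D ξ ≤ upperSupport D η + R * ‖ξ - η‖ := by
    intro ξ η
    apply upperSupport_le hne
    intro x hx
    have h1 : inner ℝ ξ x = inner ℝ η x + inner ℝ (ξ - η) x := by
      rw [← inner_add_left, add_sub_cancel]
    have h2 := real_inner_le_norm (ξ - η) x
    have h3 := inner_le_upperSupport hb hx η
    have h4 := mul_le_mul_of_nonneg_left (hR x hx) (norm_nonneg (ξ - η))
    linarith
  have h1 := key ξ η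
  have h2 := key η ξ
  rw [norm_sub_rev] at h2
  rw [abs_le]
  constructor <;> linarith

theorem lowerSupport_sub_le (hne : D.Nonempty) (hb : Bornology.IsBounded D) {R : ℝ}
    (hR : ∀ x ∈ D, ‖x‖ ≤ R) (ξ η : EuclideanSpace ℝ (Fin n)) :
    |lowerSupport D ξ - lowerSupport D η| ≤ R * ‖ξ - η‖ := by
  have := upperSupport_sub_le hne hb hR (-ξ) (-η)
  rw [upperSupport_neg, upperSupport_neg] at this
  rw [← abs_neg, ← norm_neg]
  convert this using 2
  · ring
  · congr 1
    abel

end Support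

/-! ### Polynomial marginals and affine maps -/

/-- The marginals of the uniform measure on `D` have polynomial densities of degree at most `N`
between the two support values. -/
def PolyMarginals {n : ℕ} (N : ℕ) (D : Set (EuclideanSpace ℝ (Fin n))) : Prop :=
  ∀ ξ : EuclideanSpace ℝ (Fin n), ξ ≠ 0 → ∃ P : ℝ[X], P.natDegree ≤ N ∧
    ∀ f : ℝ → ℝ, Continuous f → ∫ x in D, f (inner ℝ ξ x) =
      ∫ t in lowerSupport D ξ..upperSupport D ξ, f t * P.eval t

theorem integral_preimage_affine {n : ℕ} (L : EuclideanSpace ℝ (Fin n) ≃L[ℝ] EuclideanSpace ℝ (Fin n))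
    (c : EuclideanSpace ℝ (Fin n)) {D : Set (EuclideanSpace ℝ (Fin n))} (hD : MeasurableSet D)
    (F : EuclideanSpace ℝ (Fin n) → ℝ) :
    ∫ y in {y | L y + c ∈ D}, F (L y + c) =
      |LinearMap.det (L : EuclideanSpace ℝ (Fin n) →ₗ[ℝ] EuclideanSpace ℝ (Fin n))|⁻¹ *
        ∫ x in D, F x := by
  have hmeas : MeasurableSet {y | L y + c ∈ D} :=
    hD.preimage (by fun_prop : Measurable fun y => L y + c)
  have himg : D = (fun y => L y + c) '' {y | L y + c ∈ D} := by
    ext x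
    constructor
    · intro hx
      refine ⟨L.symm (x - c), ?_, ?_⟩ <;> simp [hx]
    · rintro ⟨y, hy, rfl⟩
      exact hy
  have hinj : InjOn (fun y => L y + c) {y | L y + c ∈ D} := by
    intro a _ b _ hab
    simpa using hab
  have hder : ∀ y ∈ {y | L y + c ∈ D}, HasFDerivWithinAt (fun y => L y + c)
      (L : EuclideanSpace ℝ (Fin n) →L[ℝ] EuclideanSpace ℝ (Fin n)) {y | L y + c ∈ D} y :=
    fun y _ => (L.hasFDerivAt.add_const c).hasFDerivWithinAt
  have := integral_image_eq_integral_abs_det_fderiv_smul volume hmeas hder hinj F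
  rw [← himg] at this
  have hdet : |LinearMap.det (L : EuclideanSpace ℝ (Fin n) →ₗ[ℝ] EuclideanSpace ℝ (Fin n))| ≠ 0 :=
    abs_ne_zero.2 (LinearEquiv.isUnit_det' L.toLinearEquiv).ne_zero
  rw [this]
  simp only [smul_eq_mul]
  rw [integral_const_mul, ← mul_assoc]
  have h2 : (L : EuclideanSpace ℝ (Fin n) →L[ℝ] EuclideanSpace ℝ (Fin n)).det =
    LinearMap.det (L : EuclideanSpace ℝ (Fin n) →ₗ[ℝ] EuclideanSpace ℝ (Fin n)) := rfl
  rw [h2, inv_mul_cancel₀ hdet, one_mul]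

theorem supports_preimage_affine {n : ℕ}
    (L : EuclideanSpace ℝ (Fin n) ≃L[ℝ] EuclideanSpace ℝ (Fin n))
    (c : EuclideanSpace ℝ (Fin n)) {D : Set (EuclideanSpace ℝ (Fin n))} (hne : D.Nonempty)
    (hb : Bornology.IsBounded D) {ξ η : EuclideanSpace ℝ (Fin n)}
    (h : ∀ y, inner ℝ ξ (L y) = inner ℝ η y) :
    upperSupport {y | L y + c ∈ D} η = upperSupport D ξ - inner ℝ ξ c ∧
      lowerSupport {y | L y + c ∈ D} η = lowerSupport D ξ - inner ℝ ξ c := by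
  have himg : (fun y => inner ℝ η y) '' {y | L y + c ∈ D} =
      (fun t => t - inner ℝ ξ c) '' ((fun x => inner ℝ ξ x) '' D) := by
    ext t
    simp only [mem_image, mem_ofPred_eq, exists_exists_and_eq_and]
    constructor
    · rintro ⟨y, hy, rfl⟩
      refine ⟨_, hy, ?_⟩
      rw [inner_add_right, h, add_sub_cancel_right]
    · rintro ⟨x, hx, rfl⟩
      refine ⟨L.symm (x - c), by simpa using hx, ?_⟩
      rw [← h, L.apply_symm_apply, inner_sub_right]
  have hmono : Monotone fun t : ℝ => t - inner ℝ ξ c := fun a b hab => sub_le_sub_right hab _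
  have hcont : Continuous fun t : ℝ => t - inner ℝ ξ c := by fun_prop
  rw [upperSupport, lowerSupport, himg]
  exact ⟨(hmono.map_csSup_of_continuousAt hcont.continuousAt (hne.image _)
    (image_inner_bddAbove hb ξ)).symm, (hmono.map_csInf_of_continuousAt hcont.continuousAt
    (hne.image _) (image_inner_bddBelow hb ξ)).symm⟩

theorem PolyMarginals.preimage_affine {n N : ℕ} {D : Set (EuclideanSpace ℝ (Fin n))}
    (h : PolyMarginals N D) (hD : IsOpen D) (hne : D.Nonempty) (hb : Bornology.IsBounded D)
    (L : EuclideanSpace ℝ (Fin n) ≃L[ℝ] EuclideanSpace ℝ (Fin n))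
    (c : EuclideanSpace ℝ (Fin n)) : PolyMarginals N {y | L y + c ∈ D} := by
  intro η hη
  -- Covectors move by the inverse transpose of `L`.
  set ξ : EuclideanSpace ℝ (Fin n) :=
    ContinuousLinearMap.adjoint (L.symm : EuclideanSpace ℝ (Fin n) →L[ℝ] EuclideanSpace ℝ (Fin n)) η
    with hξdef
  have hξ : ∀ y, inner ℝ ξ (L y) = inner ℝ η y := by
    intro y
    rw [hξdef, ContinuousLinearMap.adjoint_inner_left]
    simp
  have hξ0 : ξ ≠ 0 := by
    intro h0
    apply hη
    have := hξ η
    rw [h0, inner_zero_left] at this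
    exact inner_self_eq_zero.1 this.symm
  obtain ⟨P, hP, hPf⟩ := h ξ hξ0
  set d : ℝ := |LinearMap.det (L : EuclideanSpace ℝ (Fin n) →ₗ[ℝ] EuclideanSpace ℝ (Fin n))|⁻¹
    with hd
  refine ⟨C d * P.comp (X + C (inner ℝ ξ c)), ?_, ?_⟩
  · refine (natDegree_C_mul_le _ _).trans ?_
    rw [natDegree_comp, natDegree_X_add_C, mul_one]
    exact hP
  · intro f hf
    obtain ⟨h1, h2⟩ := supports_preimage_affine L c hne hb hξ
    rw [h1, h2]
    have h3 := integral_preimage_affine L c hD.measurableSet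
      (fun x => f (inner ℝ ξ x - inner ℝ ξ c))
    simp only [inner_add_right, hξ, add_sub_cancel_right] at h3
    rw [h3, hPf (fun t => f (t - inner ℝ ξ c)) (by fun_prop), ← hd,
      ← intervalIntegral.integral_const_mul]
    have h4 := intervalIntegral.integral_comp_sub_right (a := lowerSupport D ξ)
      (b := upperSupport D ξ)
      (fun t => f t * (C d * P.comp (X + C (inner ℝ ξ c))).eval t) (inner ℝ ξ c)
    rw [← h4]
    congr 1
    funext t
    simp only [eval_mul, eval_C, eval_comp, eval_add, eval_X, sub_add_cancel]
    ring

theorem Continuous.integrableOn_of_isBounded {E F : Type*} [NormedAddCommGroup E]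
    [NormedSpace ℝ E] [FiniteDimensional ℝ E] [MeasureSpace E] [BorelSpace E]
    [IsFiniteMeasureOnCompacts (volume : Measure E)] [NormedAddCommGroup F]
    {f : E → F} (hf : Continuous f) {D : Set E} (hD : Bornology.IsBounded D) :
    IntegrableOn f D := by
  have : ProperSpace E := FiniteDimensional.proper_real E
  obtain ⟨R, hR⟩ := hD.subset_closedBall 0
  exact (hf.continuousOn.integrableOn_compact (isCompact_closedBall 0 R)).mono_set hR

/-! ### Moments as exponential polynomials -/

/-- The polynomial `∑ j, a j * ∏ i ≠ j, (X + i + 1)`. -/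
noncomputable def lagrangeComb (N : ℕ) (a : ℕ → ℝ) : ℝ[X] :=
  ∑ j ∈ Finset.range (N + 1), C (a j) * ∏ i ∈ (Finset.range (N + 1)).erase j, (X + C ((i : ℝ) + 1))

theorem natDegree_lagrangeComb_lt (N : ℕ) (a : ℕ → ℝ) : (lagrangeComb N a).natDegree < N + 1 := by
  apply Nat.lt_succ_of_le
  apply natDegree_sum_le_of_forall_le
  intro j hj
  refine (natDegree_C_mul_le _ _).trans ((natDegree_prod_le _ _).trans ?_)
  simp only [natDegree_X_add_C, Finset.sum_const, smul_eq_mul, mul_one]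
  rw [Finset.card_erase_of_mem hj]
  simp

theorem lagrangeComb_ne_zero {N : ℕ} {a : ℕ → ℝ} {j : ℕ} (hj : j ≤ N) (ha : a j ≠ 0) :
    lagrangeComb N a ≠ 0 := by
  intro h
  -- At `-(j + 1)` every summand except the `j`-th vanishes.
  have h1 : (lagrangeComb N a).eval (-((j : ℝ) + 1)) = 0 := by rw [h, eval_zero]
  rw [lagrangeComb, eval_finsetSum, Finset.sum_eq_single j] at h1
  · rw [eval_mul, eval_C, mul_eq_zero, eval_prod, Finset.prod_eq_zero_iff] at h1
    rcases h1 with h1 | ⟨i, hi, h1⟩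
    · exact ha h1
    · simp only [eval_add, eval_X, eval_C] at h1
      apply (Finset.mem_erase.1 hi).1
      have : (i : ℝ) = j := by linarith
      exact_mod_cast this
  · intro i _ hij
    rw [eval_mul, eval_prod, Finset.prod_eq_zero (i := j), mul_zero]
    · exact Finset.mem_erase.2 ⟨hij.symm, by simpa using Nat.lt_succ_of_le hj⟩
    · simp
  · intro h0
    exact absurd (Finset.mem_range.2 (Nat.lt_succ_of_le hj)) h0

theorem lagrangeComb_eval (N : ℕ) (a : ℕ → ℝ) (k : ℕ) :
    (lagrangeComb N a).eval (k : ℝ) =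
      (∏ i ∈ Finset.range (N + 1), ((k : ℝ) + i + 1)) *
        ∑ j ∈ Finset.range (N + 1), a j / ((k : ℝ) + j + 1) := by
  rw [lagrangeComb, eval_finsetSum, Finset.mul_sum]
  refine Finset.sum_congr rfl fun j hj => ?_
  have hpos : ((k : ℝ) + j + 1) ≠ 0 := by positivity
  rw [← Finset.mul_prod_erase _ _ hj, eval_mul, eval_C, eval_prod]
  simp only [eval_add, eval_X, eval_C, ← add_assoc]
  field_simp

theorem intervalIntegral_pow_mul_eval (P : ℝ[X]) {N : ℕ} (hP : P.natDegree ≤ N) (l m : ℝ) (k : ℕ) :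
    ∫ t in m..l, t ^ k * P.eval t = ∑ j ∈ Finset.range (N + 1),
      (P.coeff j * l ^ (j + 1) / ((k : ℝ) + j + 1) * l ^ k -
        P.coeff j * m ^ (j + 1) / ((k : ℝ) + j + 1) * m ^ k) := by
  have h1 : (fun t : ℝ => t ^ k * P.eval t) =
      fun t => ∑ j ∈ Finset.range (N + 1), P.coeff j * t ^ (k + j) := by
    funext t
    rw [eval_eq_sum_range' (Nat.lt_succ_of_le hP), Finset.mul_sum]
    refine Finset.sum_congr rfl fun j _ => ?_
    ring
  rw [h1, intervalIntegral.integral_finsetSum]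
  · refine Finset.sum_congr rfl fun j _ => ?_
    rw [intervalIntegral.integral_const_mul, integral_pow]
    push_cast
    ring
  · intro j _
    exact (by fun_prop : Continuous fun t : ℝ => P.coeff j * t ^ (k + j)).intervalIntegrable _ _

section Moments

variable {n : ℕ} {D : Set (EuclideanSpace ℝ (Fin n))}

theorem exists_moment_polynomial (hb : Bornology.IsBounded D) (x y : EuclideanSpace ℝ (Fin n))
    (k : ℕ) : ∃ M : ℝ[X], ∀ s : ℝ, M.eval s = ∫ z in D, (inner ℝ (x + s • y) z) ^ k := by
  refine ⟨∑ j ∈ Finset.range (k + 1),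
    C (∫ z in D, inner ℝ x z ^ j * inner ℝ y z ^ (k - j) * (k.choose j : ℝ)) * X ^ (k - j),
    fun s => ?_⟩
  have h1 : (fun z => (inner ℝ (x + s • y) z) ^ k) = fun z => ∑ j ∈ Finset.range (k + 1),
      inner ℝ x z ^ j * inner ℝ y z ^ (k - j) * (k.choose j : ℝ) * s ^ (k - j) := by
    funext z
    rw [inner_add_left, real_inner_smul_left, add_pow]
    refine Finset.sum_congr rfl fun j _ => ?_
    ring
  rw [h1, integral_finsetSum]
  · rw [eval_finsetSum]
    refine Finset.sum_congr rfl fun j _ => ?_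
    rw [eval_mul, eval_C, eval_pow, eval_X, ← integral_mul_const]
  · intro j _
    exact Continuous.integrableOn_of_isBounded (by fun_prop) hb

/-- Integrating `t ^ (k + j)` produces the denominators `k + j + 1`. The product clears them, which
makes the coefficients of the two powers polynomial in `k`. -/
theorem PolyMarginals.exists_expPoly {N : ℕ} (h : PolyMarginals N D) (hD : IsOpen D)
    (hne : D.Nonempty) (hb : Bornology.IsBounded D) {ξ : EuclideanSpace ℝ (Fin n)} (hξ : ξ ≠ 0)
    (hu : upperSupport D ξ ≠ 0) (hl : lowerSupport D ξ ≠ 0) :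
    ∃ α β : ℝ[X], α ≠ 0 ∧ β ≠ 0 ∧ α.natDegree < N + 1 ∧ β.natDegree < N + 1 ∧ ∀ k : ℕ,
      (∏ i ∈ Finset.range (N + 1), ((k : ℝ) + i + 1)) * ∫ z in D, inner ℝ ξ z ^ k =
        α.eval (k : ℝ) * upperSupport D ξ ^ k + β.eval (k : ℝ) * lowerSupport D ξ ^ k := by
  obtain ⟨P, hPN, hP⟩ := h ξ hξ
  have hP0 : P ≠ 0 := by
    rintro rfl
    have h1 := hP (fun _ => 1) continuous_const
    have h2 : (volume D).toReal = 0 := by simpa [Measure.real] using h1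
    rw [ENNReal.toReal_eq_zero_iff] at h2
    rcases h2 with h2 | h2
    · exact (hD.measure_pos volume hne).ne' h2
    · exact hb.measure_lt_top.ne h2
  obtain ⟨j, hj⟩ : ∃ j, P.coeff j ≠ 0 := by
    by_contra! hc
    exact hP0 (Polynomial.ext hc)
  have hjN : j ≤ N := (le_natDegree_of_ne_zero hj).trans hPN
  refine ⟨lagrangeComb N fun j => P.coeff j * upperSupport D ξ ^ (j + 1),
    lagrangeComb N fun j => -(P.coeff j * lowerSupport D ξ ^ (j + 1)),
    lagrangeComb_ne_zero hjN (mul_ne_zero hj (pow_ne_zero _ hu)),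
    lagrangeComb_ne_zero hjN (neg_ne_zero.2 (mul_ne_zero hj (pow_ne_zero _ hl))),
    natDegree_lagrangeComb_lt _ _, natDegree_lagrangeComb_lt _ _, fun k => ?_⟩
  rw [hP (fun t => t ^ k) (by fun_prop), intervalIntegral_pow_mul_eval P hPN, lagrangeComb_eval,
    lagrangeComb_eval, mul_assoc, mul_assoc, ← mul_add, Finset.sum_mul, Finset.sum_mul,
    ← Finset.sum_add_distrib]
  congr 1
  refine Finset.sum_congr rfl fun j _ => ?_
  ring

/-- The support functions are Lipschitz and positively homogeneous, so their values at `x + s • y`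
and at `s • y` differ by at most `R * ‖x‖`; for `s ≤ 0` the upper one at `s • y` is `s` times the
lower one at `y`, and conversely. -/
theorem PolyMarginals.supports_on_line {N : ℕ} (h : PolyMarginals N D) (hD : IsOpen D)
    (h0 : (0 : EuclideanSpace ℝ (Fin n)) ∈ D) (hb : Bornology.IsBounded D)
    {x y : EuclideanSpace ℝ (Fin n)} (hxy : ∀ s : ℝ, x + s • y ≠ 0) (hy : y ≠ 0) :
    (∃ e, ∀ s : ℝ, upperSupport D (x + s • y) + lowerSupport D (x + s • y) =
      e + s * (upperSupport D y + lowerSupport D y)) ∧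
    ∃ A B, ∀ s : ℝ, (upperSupport D (x + s • y) - lowerSupport D (x + s • y)) ^ 2 =
      A + B * s + (upperSupport D y - lowerSupport D y) ^ 2 * s ^ 2 := by
  have hne : D.Nonempty := ⟨0, h0⟩
  have hpos : ∀ ξ : EuclideanSpace ℝ (Fin n), ξ ≠ 0 → 0 < upperSupport D ξ := by
    intro ξ hξ
    simpa using inner_lt_upperSupport hD hb h0 hξ
  have hneg : ∀ ξ : EuclideanSpace ℝ (Fin n), ξ ≠ 0 → lowerSupport D ξ < 0 := by
    intro ξ hξ
    simpa using lowerSupport_lt_inner hD hb h0 hξ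
  obtain ⟨R, hR⟩ := hb.exists_norm_le
  have hR0 : 0 ≤ R := by simpa using hR 0 h0
  have hcu : Continuous (upperSupport D) := by
    refine (LipschitzWith.of_dist_le_mul (K := ⟨R, hR0⟩) fun a b => ?_).continuous
    rw [Real.dist_eq, dist_eq_norm]
    exact upperSupport_sub_le hne hb hR a b
  have hcl : Continuous (lowerSupport D) := by
    refine (LipschitzWith.of_dist_le_mul (K := ⟨R, hR0⟩) fun a b => ?_).continuous
    rw [Real.dist_eq, dist_eq_norm]
    exact lowerSupport_sub_le hne hb hR a b
  choose M hM using exists_moment_polynomial hb x y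
  set g : ℕ → ℝ[X] := fun k => C (∏ i ∈ Finset.range (N + 1), ((k : ℝ) + i + 1)) * M k with hg
  obtain ⟨r, c₁, c₂, H, hH, hr⟩ := exists_powerSums (g := g)
    (l := fun s => upperSupport D (x + s • y)) (m := fun s => lowerSupport D (x + s • y))
    (N := N + 1) (by
      intro s
      have hs := hxy s
      refine ⟨(hpos _ hs).ne', (hneg _ hs).ne, ((hneg _ hs).trans (hpos _ hs)).ne', ?_⟩
      obtain ⟨α, β, hα, hβ, hαd, hβd, hk⟩ := h.exists_expPoly hD hne hb hs (hpos _ hs).ne'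
        (hneg _ hs).ne
      refine ⟨α, β, hα, hβ, hαd, hβd, fun k => ?_⟩
      rw [← hk, hg, eval_mul, eval_C, hM])
  have hns : ∀ s : ℝ, s ≤ 0 → s • y = (-s) • (-y) := fun s _ => by simp
  refine two_exponents_on_line (l := fun s => upperSupport D (x + s • y))
    (m := fun s => lowerSupport D (x + s • y)) (hcu.comp (by fun_prop)) (hcl.comp (by fun_prop))
    (fun s => ((hneg _ (hxy s)).trans (hpos _ (hxy s))).ne')
    (L := upperSupport D y) (M := lowerSupport D y) (K := R * ‖x‖)
    ((hneg _ hy).trans (hpos _ hy)).ne' ?_ ?_ ?_ ?_ hH hr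
  · intro s hs
    rw [← upperSupport_smul hs]
    simpa using upperSupport_sub_le hne hb hR (x + s • y) (s • y)
  · intro s hs
    rw [← lowerSupport_smul hs]
    simpa using lowerSupport_sub_le hne hb hR (x + s • y) (s • y)
  · intro s hs
    have h1 : s * lowerSupport D y = upperSupport D (s • y) := by
      rw [hns s hs, upperSupport_smul (by linarith), upperSupport_neg]
      ring
    rw [h1]
    simpa using upperSupport_sub_le hne hb hR (x + s • y) (s • y)
  · intro s hs
    have h1 : s * upperSupport D y = lowerSupport D (s • y) := by
      rw [hns s hs, lowerSupport_smul (by linarith), lowerSupport_neg]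
      ring
    rw [h1]
    simpa using lowerSupport_sub_le hne hb hR (x + s • y) (s • y)

end Moments

/-! ### From lines to a linear form and a quadratic form -/

section Quadratic

variable {n : ℕ}

/-- Polarisation as in the Jordan–von Neumann theorem. Being quadratic on lines yields the
parallelogram law, and also homogeneity in each argument, so no continuity is needed. -/
theorem exists_bilinear_of_quadratic_on_lines {G : EuclideanSpace ℝ (Fin n) → ℝ}
    (hG : ∀ x y, ∃ B : ℝ, ∀ s : ℝ, G (x + s • y) = G x + B * s + G y * s ^ 2)
    (hhom : ∀ (t : ℝ) x, G (t • x) = t ^ 2 * G x) :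
    ∃ b : EuclideanSpace ℝ (Fin n) →ₗ[ℝ] EuclideanSpace ℝ (Fin n) →ₗ[ℝ] ℝ,
      (∀ x y, b x y = b y x) ∧ ∀ x, b x x = G x := by
  set β : EuclideanSpace ℝ (Fin n) → EuclideanSpace ℝ (Fin n) → ℝ :=
    fun x y => (G (x + y) - G (x - y)) / 4 with hβ
  have hneg : ∀ x, G (-x) = G x := fun x => by simpa using hhom (-1) x
  have hG0 : G 0 = 0 := by simpa using hhom 0 0
  have hsymm : ∀ x y, β x y = β y x := by
    intro x y
    simp only [hβ]
    rw [add_comm, ← hneg (x - y), neg_sub]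
  have hsmul : ∀ (s : ℝ) x y, β x (s • y) = s * β x y := by
    intro s x y
    obtain ⟨B, hB⟩ := hG x y
    have h1 := hB s
    have h2 := hB (-s)
    have h3 := hB 1
    have h4 := hB (-1)
    simp only [neg_smul, one_smul, ← sub_eq_add_neg] at h1 h2 h3 h4
    simp only [hβ]
    rw [h1, h2, h3, h4]
    ring
  have hpar : ∀ x y, G (x + y) + G (x - y) = 2 * G x + 2 * G y := by
    intro x y
    obtain ⟨B, hB⟩ := hG x y
    have h3 := hB 1
    have h4 := hB (-1)
    simp only [neg_smul, one_smul, ← sub_eq_add_neg] at h3 h4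
    rw [h3, h4]
    ring
  have hmid : ∀ x x' y, β (x + x') y + β (x - x') y = 2 * β x y := by
    intro x x' y
    have h1 := hpar (x + y) x'
    have h2 := hpar (x - y) x'
    rw [show x + y + x' = x + x' + y by abel, show x + y - x' = x - x' + y by abel] at h1
    rw [show x - y + x' = x + x' - y by abel, show x - y - x' = x - x' - y by abel] at h2
    simp only [hβ]
    linarith
  have hsmul' : ∀ (s : ℝ) x y, β (s • x) y = s * β x y := by
    intro s x y
    rw [hsymm, hsmul, hsymm]
  have hadd : ∀ x x' y, β (x + x') y = β x y + β x' y := by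
    intro x x' y
    have h1 := hmid ((1 / 2 : ℝ) • (x + x')) ((1 / 2 : ℝ) • (x - x')) y
    rw [hsmul'] at h1
    rw [show (1 / 2 : ℝ) • (x + x') + (1 / 2 : ℝ) • (x - x') = x by module,
      show (1 / 2 : ℝ) • (x + x') - (1 / 2 : ℝ) • (x - x') = x' by module] at h1
    linarith
  refine ⟨LinearMap.mk₂ ℝ β hadd hsmul' (fun x y y' => ?_) hsmul, fun x y => hsymm x y,
    fun x => ?_⟩
  · rw [hsymm, hadd, hsymm y, hsymm y']
  · change (G (x + x) - G (x - x)) / 4 = G x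
    rw [sub_self, hG0, ← two_smul ℝ x, hhom]
    ring

theorem exists_orthonormalBasis_of_bilinear
    (b : EuclideanSpace ℝ (Fin n) →ₗ[ℝ] EuclideanSpace ℝ (Fin n) →ₗ[ℝ] ℝ)
    (hb : ∀ x y, b x y = b y x) :
    ∃ (e : OrthonormalBasis (Fin n) ℝ (EuclideanSpace ℝ (Fin n))) (μ : Fin n → ℝ),
      ∀ x, b x x = ∑ j, μ j * inner ℝ (e j) x ^ 2 := by
  set v := EuclideanSpace.basisFun (Fin n) ℝ
  set A : EuclideanSpace ℝ (Fin n) →ₗ[ℝ] EuclideanSpace ℝ (Fin n) :=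
    ∑ i, (b.flip (v i)).smulRight (v i) with hA
  have hAb : ∀ x y, inner ℝ (A x) y = b x y := by
    intro x y
    conv_rhs => rw [← v.sum_repr' y]
    rw [hA, LinearMap.sum_apply, sum_inner, map_sum]
    refine Finset.sum_congr rfl fun i _ => ?_
    rw [LinearMap.smulRight_apply, real_inner_smul_left, map_smul, LinearMap.flip_apply,
      smul_eq_mul, mul_comm]
  have hAs : A.IsSymmetric := by
    intro x y
    rw [hAb, real_inner_comm, hAb, hb]
  refine ⟨hAs.eigenvectorBasis finrank_euclideanSpace_fin,
    hAs.eigenvalues finrank_euclideanSpace_fin, fun x => ?_⟩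
  set e := hAs.eigenvectorBasis finrank_euclideanSpace_fin
  rw [← hAb, ← e.sum_inner_mul_inner]
  refine Finset.sum_congr rfl fun j _ => ?_
  rw [hAs, hAs.apply_eigenvectorBasis, RCLike.ofReal_real_eq_id, id, real_inner_smul_right,
    real_inner_comm, mul_assoc, sq]

variable {D : Set (EuclideanSpace ℝ (Fin n))}

/-- The support functions of a bounded open set with polynomial marginals are those of an
ellipsoid. -/
theorem PolyMarginals.exists_ellipsoid_supports {N : ℕ} (h : PolyMarginals N D) (hD : IsOpen D)
    (h0 : (0 : EuclideanSpace ℝ (Fin n)) ∈ D) (hb : Bornology.IsBounded D) :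
    ∃ (c : EuclideanSpace ℝ (Fin n)) (e : OrthonormalBasis (Fin n) ℝ (EuclideanSpace ℝ (Fin n)))
      (b : Fin n → ℝ), (∀ j, 0 < b j) ∧ ∀ ξ,
      upperSupport D ξ = inner ℝ ξ c + √(∑ j, b j ^ 2 * inner ℝ (e j) ξ ^ 2) ∧
      lowerSupport D ξ = inner ℝ ξ c - √(∑ j, b j ^ 2 * inner ℝ (e j) ξ ^ 2) := by
  have hlt : ∀ ξ : EuclideanSpace ℝ (Fin n), ξ ≠ 0 → lowerSupport D ξ < upperSupport D ξ :=
    fun ξ hξ => (lowerSupport_lt_inner hD hb h0 hξ).trans (inner_lt_upperSupport hD hb h0 hξ)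
  have hu0 : upperSupport D 0 = 0 := by
    simpa using upperSupport_smul (D := D) (le_refl (0 : ℝ)) 0
  have hl0 : lowerSupport D 0 = 0 := by
    simpa using lowerSupport_smul (D := D) (le_refl (0 : ℝ)) 0
  set S : EuclideanSpace ℝ (Fin n) → ℝ := fun ξ => upperSupport D ξ + lowerSupport D ξ with hS
  set G : EuclideanSpace ℝ (Fin n) → ℝ := fun ξ => (upperSupport D ξ - lowerSupport D ξ) ^ 2
    with hGdef
  have hShom : ∀ (t : ℝ) ξ, S (t • ξ) = t * S ξ := by
    intro t ξ
    rcases le_total 0 t with ht | ht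
    · simp only [hS, upperSupport_smul ht, lowerSupport_smul ht]
      ring
    · have : t • ξ = (-t) • (-ξ) := by simp
      simp only [hS, this, upperSupport_smul (neg_nonneg.2 ht),
        lowerSupport_smul (neg_nonneg.2 ht), upperSupport_neg, lowerSupport_neg]
      ring
  have hGhom : ∀ (t : ℝ) ξ, G (t • ξ) = t ^ 2 * G ξ := by
    intro t ξ
    rcases le_total 0 t with ht | ht
    · simp only [hGdef, upperSupport_smul ht, lowerSupport_smul ht]
      ring
    · have : t • ξ = (-t) • (-ξ) := by simp
      simp only [hGdef, this, upperSupport_smul (neg_nonneg.2 ht),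
        lowerSupport_smul (neg_nonneg.2 ht), upperSupport_neg, lowerSupport_neg]
      ring
  -- On a line through the origin the exponents degenerate at zero; there homogeneity takes over.
  have hline : ∀ x y : EuclideanSpace ℝ (Fin n), y ≠ 0 → (∃ s₀ : ℝ, x = s₀ • y) ∨
      ((∃ e, ∀ s : ℝ, S (x + s • y) = e + s * S y) ∧
        ∃ A B, ∀ s : ℝ, G (x + s • y) = A + B * s + G y * s ^ 2) := by
    intro x y hy
    by_cases hxy : ∀ s : ℝ, x + s • y ≠ 0
    · exact Or.inr (h.supports_on_line hD h0 hb hxy hy)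
    · push Not at hxy
      obtain ⟨s, hs⟩ := hxy
      exact Or.inl ⟨-s, by rw [neg_smul]; exact eq_neg_of_add_eq_zero_left hs⟩
  have hSadd : ∀ x y, S (x + y) = S x + S y := by
    intro x y
    by_cases hy : y = 0
    · subst hy
      simp [hS, hu0, hl0]
    rcases hline x y hy with ⟨s₀, rfl⟩ | ⟨⟨e, he⟩, -⟩
    · have : s₀ • y + y = (s₀ + 1) • y := by module
      rw [this, hShom, hShom]
      ring
    · have h1 := he 1
      have h2 := he 0
      simp only [one_smul, zero_smul, add_zero, zero_mul] at h1 h2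
      rw [h1, h2]
      ring
  have hGline : ∀ x y, ∃ B : ℝ, ∀ s : ℝ, G (x + s • y) = G x + B * s + G y * s ^ 2 := by
    intro x y
    by_cases hy : y = 0
    · subst hy
      exact ⟨0, fun s => by simp [hGdef, hu0, hl0]⟩
    rcases hline x y hy with ⟨s₀, rfl⟩ | ⟨-, A, B, hAB⟩
    · refine ⟨2 * s₀ * G y, fun s => ?_⟩
      have : s₀ • y + s • y = (s₀ + s) • y := by module
      rw [this, hGhom, hGhom]
      ring
    · refine ⟨B, fun s => ?_⟩
      have h2 := hAB 0
      simp only [zero_smul, add_zero, mul_zero, zero_pow two_ne_zero] at h2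
      rw [hAB, h2]
  obtain ⟨β, hβs, hβ⟩ := exists_bilinear_of_quadratic_on_lines hGline hGhom
  obtain ⟨e, μ, hμ⟩ := exists_orthonormalBasis_of_bilinear β hβs
  have hGe : ∀ ξ, G ξ = ∑ j, μ j * inner ℝ (e j) ξ ^ 2 := fun ξ => by rw [← hβ, hμ]
  have hμpos : ∀ j, 0 < μ j := by
    intro j
    have h1 := hGe (e j)
    rw [Finset.sum_eq_single j, real_inner_self_eq_norm_sq, e.norm_eq_one] at h1
    · have h2 : 0 < G (e j) := by
        have := hlt (e j) (e.orthonormal.ne_zero j)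
        exact pow_pos (by linarith) 2
      linarith
    · intro i _ hij
      rw [e.inner_eq_zero hij]
      simp
    · simp
  set L : EuclideanSpace ℝ (Fin n) →ₗ[ℝ] ℝ :=
    { toFun := S, map_add' := hSadd, map_smul' := hShom } with hL
  -- For an ellipsoid `h⁺ + h⁻ = 2 ⟨·, c⟩` and `(h⁺ - h⁻)² = 4 ∑ b j² ⟨e j, ·⟩²`, whence both
  -- halves.
  refine ⟨∑ j, (S (e j) / 2) • e j, e, fun j => √(μ j) / 2,
    fun j => by have := Real.sqrt_pos.2 (hμpos j); positivity, fun ξ => ?_⟩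
  have hc : inner ℝ ξ (∑ j, (S (e j) / 2) • e j) = S ξ / 2 := by
    have h1 : S ξ = ∑ j, inner ℝ (e j) ξ * S (e j) := by
      change L ξ = _
      conv_lhs => rw [← e.sum_repr' ξ]
      rw [map_sum]
      refine Finset.sum_congr rfl fun j _ => ?_
      rw [map_smul, smul_eq_mul]
      rfl
    rw [inner_sum, h1, Finset.sum_div]
    refine Finset.sum_congr rfl fun j _ => ?_
    rw [real_inner_smul_right, real_inner_comm]
    ring
  have hle : lowerSupport D ξ ≤ upperSupport D ξ := by
    by_cases hξ : ξ = 0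
    · rw [hξ, hu0, hl0]
    · exact (hlt ξ hξ).le
  have hw : √(∑ j, (√(μ j) / 2) ^ 2 * inner ℝ (e j) ξ ^ 2) =
      (upperSupport D ξ - lowerSupport D ξ) / 2 := by
    rw [Real.sqrt_eq_iff_mul_self_eq (Finset.sum_nonneg fun j _ => by positivity) (by linarith)]
    have h1 := hGe ξ
    simp only [hGdef] at h1
    have h2 : ∑ j, (√(μ j) / 2) ^ 2 * inner ℝ (e j) ξ ^ 2 =
        (∑ j, μ j * inner ℝ (e j) ξ ^ 2) / 4 := by
      rw [Finset.sum_div]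
      refine Finset.sum_congr rfl fun j _ => ?_
      rw [div_pow, Real.sq_sqrt (hμpos j).le]
      ring
    rw [h2, ← h1]
    ring
  rw [hc, hw]
  constructor <;> · simp only [hS]; ring

end Quadratic

/-! ### Fubini: section volumes are marginal densities -/

section Slices

variable {n : ℕ}

/-- Fubini's theorem along the hyperplanes orthogonal to a unit vector. -/
theorem integral_eq_integral_slices {ω : EuclideanSpace ℝ (Fin n)} (hω : ‖ω‖ = 1)
    {g : EuclideanSpace ℝ (Fin n) → ℝ} (hg : Integrable g) :
    ∫ x, g x = ∫ t : ℝ, ∫ y : (Submodule.span ℝ {ω})ᗮ, g (t • ω + (y : EuclideanSpace ℝ (Fin n))) := by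
  set K := Submodule.span ℝ {ω}
  set e₁ : (ℝ × Kᗮ) ≃ᵐ (K × Kᗮ) := MeasurableEquiv.prodCongr
    (LinearIsometryEquiv.toSpanUnitSingleton ω hω).toMeasurableEquiv (MeasurableEquiv.refl _)
  have h₁ : MeasurePreserving e₁ volume volume :=
    (LinearIsometryEquiv.toSpanUnitSingleton ω hω).measurePreserving.prod
      (MeasurePreserving.id volume)
  have h₂ : MeasurePreserving (MeasurableEquiv.toLp 2 (K × Kᗮ)) volume volume :=
    WithLp.volume_preserving_toLp K Kᗮ
  have h₃ : MeasurePreserving (K.orthogonalDecomposition.symm.toMeasurableEquiv) volume volume :=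
    K.orthogonalDecomposition.symm.measurePreserving
  set e : (ℝ × Kᗮ) ≃ᵐ EuclideanSpace ℝ (Fin n) :=
    (e₁.trans (MeasurableEquiv.toLp 2 (K × Kᗮ))).trans
      K.orthogonalDecomposition.symm.toMeasurableEquiv with he
  have h : MeasurePreserving e volume volume := h₃.comp (h₂.comp h₁)
  have hap : ∀ p : ℝ × Kᗮ, e p = p.1 • ω + (p.2 : EuclideanSpace ℝ (Fin n)) := by
    intro p
    rfl
  rw [← h.integral_comp' g]
  have hint : Integrable (fun p => g (e p)) (volume : Measure (ℝ × Kᗮ)) :=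
    h.integrable_comp_of_integrable hg
  rw [Measure.volume_eq_prod] at hint ⊢
  rw [integral_prod _ hint]
  simp only [hap]

variable {D : Set (EuclideanSpace ℝ (Fin n))}

theorem inner_smul_add_orthogonal {ω : EuclideanSpace ℝ (Fin n)} (hω : ‖ω‖ = 1) (t : ℝ)
    (y : (Submodule.span ℝ {ω})ᗮ) :
    inner ℝ ω (t • ω + (y : EuclideanSpace ℝ (Fin n))) = t := by
  have h1 : inner ℝ ω (y : EuclideanSpace ℝ (Fin n)) = 0 :=
    Submodule.mem_orthogonal_singleton_iff_inner_right.1 y.2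
  rw [inner_add_right, inner_smul_right, real_inner_self_eq_norm_sq, hω, h1]
  simp

theorem measurableSet_slice (hD : IsOpen D) (ω : EuclideanSpace ℝ (Fin n)) (t : ℝ) :
    MeasurableSet {y : (Submodule.span ℝ {ω})ᗮ | t • ω + (y : EuclideanSpace ℝ (Fin n)) ∈ D} :=
  (hD.preimage (by fun_prop : Continuous fun y : (Submodule.span ℝ {ω})ᗮ =>
    t • ω + (y : EuclideanSpace ℝ (Fin n)))).measurableSet

/-- The marginal of the uniform measure on `D` has density `sectionVolume D ω`. -/
theorem integral_comp_inner_eq (hD : IsOpen D) (hb : Bornology.IsBounded D)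
    {ω : EuclideanSpace ℝ (Fin n)} (hω : ‖ω‖ = 1) {f : ℝ → ℝ} (hf : Continuous f) :
    ∫ x in D, f (inner ℝ ω x) = ∫ t, f t * sectionVolume D ω t := by
  have hint : IntegrableOn (fun x => f (inner ℝ ω x)) D :=
    Continuous.integrableOn_of_isBounded (by fun_prop) hb
  rw [← integral_indicator hD.measurableSet,
    integral_eq_integral_slices hω (hint.integrable_indicator hD.measurableSet)]
  congr 1
  funext t
  have h1 : (fun y : (Submodule.span ℝ {ω})ᗮ =>
      D.indicator (fun x => f (inner ℝ ω x)) (t • ω + (y : EuclideanSpace ℝ (Fin n)))) =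
      {y : (Submodule.span ℝ {ω})ᗮ | t • ω + (y : EuclideanSpace ℝ (Fin n)) ∈ D}.indicator
        (fun _ => f t) := by
    funext y
    by_cases hy : t • ω + (y : EuclideanSpace ℝ (Fin n)) ∈ D
    · rw [indicator_of_mem hy, indicator_of_mem (by exact hy), inner_smul_add_orthogonal hω]
    · rw [indicator_of_notMem hy, indicator_of_notMem (by exact hy)]
  rw [h1, integral_indicator_const _ (measurableSet_slice hD ω t), smul_eq_mul, mul_comm]
  rfl

theorem sectionVolume_eq_zero (hD : IsOpen D) (hb : Bornology.IsBounded D)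
    {ω : EuclideanSpace ℝ (Fin n)} (hω : ‖ω‖ = 1) {t : ℝ}
    (ht : t ∉ Ioo (lowerSupport D ω) (upperSupport D ω)) : sectionVolume D ω t = 0 := by
  have hω0 : ω ≠ 0 := by
    rintro rfl
    simp at hω
  have : {y : (Submodule.span ℝ {ω})ᗮ | t • ω + (y : EuclideanSpace ℝ (Fin n)) ∈ D} = ∅ := by
    rw [eq_empty_iff_forall_notMem]
    intro y hy
    apply ht
    have h1 := lowerSupport_lt_inner hD hb hy hω0
    have h2 := inner_lt_upperSupport hD hb hy hω0
    rw [inner_smul_add_orthogonal hω] at h1 h2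
    exact ⟨h1, h2⟩
  rw [sectionVolume, this]
  simp

theorem polyMarginals_of_sectionVolume (hD : IsOpen D) (hne : D.Nonempty)
    (hb : Bornology.IsBounded D) {N : ℕ}
    (h : ∀ ω : EuclideanSpace ℝ (Fin n), ‖ω‖ = 1 → ∃ P : ℝ[X], P.natDegree ≤ N ∧
      ∀ t ∈ Ioo (lowerSupport D ω) (upperSupport D ω), sectionVolume D ω t = P.eval t) :
    PolyMarginals N D := by
  intro ξ hξ
  have hr : 0 < ‖ξ‖ := norm_pos_iff.2 hξ
  set r := ‖ξ‖ with hrdef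
  set ω := r⁻¹ • ξ with hωdef
  have hω : ‖ω‖ = 1 := by
    rw [hωdef, norm_smul, norm_inv, Real.norm_of_nonneg hr.le, inv_mul_cancel₀ hr.ne']
  have hξω : ξ = r • ω := by rw [hωdef, smul_inv_smul₀ hr.ne']
  have hω0 : ω ≠ 0 := by
    intro h0
    rw [h0, norm_zero] at hω
    exact zero_ne_one hω
  obtain ⟨P, hPN, hP⟩ := h ω hω
  have hlt : lowerSupport D ω < upperSupport D ω := by
    obtain ⟨x, hx⟩ := hne
    exact (lowerSupport_lt_inner hD hb hx hω0).trans (inner_lt_upperSupport hD hb hx hω0)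
  have key : ∀ f : ℝ → ℝ, Continuous f → ∫ x in D, f (inner ℝ ω x) =
      ∫ t in lowerSupport D ω..upperSupport D ω, f t * P.eval t := by
    intro f hf
    rw [integral_comp_inner_eq hD hb hω hf, intervalIntegral.integral_of_le hlt.le,
      integral_Ioc_eq_integral_Ioo, ← setIntegral_eq_integral_of_forall_compl_eq_zero
        (s := Ioo (lowerSupport D ω) (upperSupport D ω))
        (fun t ht => by rw [sectionVolume_eq_zero hD hb hω ht, mul_zero])]
    refine setIntegral_congr_fun measurableSet_Ioo fun t ht => ?_
    simp only [hP t ht]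
  refine ⟨C r⁻¹ * P.comp (C r⁻¹ * X), ?_, fun f hf => ?_⟩
  · refine (natDegree_C_mul_le _ _).trans (natDegree_comp_le.trans ?_)
    calc P.natDegree * (C r⁻¹ * X : ℝ[X]).natDegree ≤ P.natDegree * 1 :=
          Nat.mul_le_mul_left _ ((natDegree_C_mul_le _ _).trans natDegree_X_le)
      _ ≤ N := by omega
  · have h1 := key (fun t => f (r * t)) (by fun_prop)
    have h2 : ∀ x : EuclideanSpace ℝ (Fin n), inner ℝ ξ x = r * inner ℝ ω x := by
      intro x
      rw [← real_inner_smul_left, ← hξω]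
    simp only [h2]
    rw [h1, hξω, upperSupport_smul hr.le, lowerSupport_smul hr.le]
    have h3 := intervalIntegral.integral_comp_mul_left (a := lowerSupport D ω)
      (b := upperSupport D ω) (fun u => f u * P.eval (r⁻¹ * u)) hr.ne'
    simp only [inv_mul_cancel_left₀ hr.ne'] at h3
    rw [h3, smul_eq_mul, ← intervalIntegral.integral_const_mul]
    congr 1
    funext u
    simp only [eval_mul, eval_C, eval_comp, eval_X]
    ring

end Slices

/-! ### Radon transforms on the unit ball -/

section Ball

variable {n : ℕ}

theorem integral_unitBall_inner_pow_odd {F : Type*} [NormedAddCommGroup F]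
    [InnerProductSpace ℝ F] [FiniteDimensional ℝ F] [MeasurableSpace F] [BorelSpace F]
    (φ : F →L[ℝ] ℝ) {i : ℕ} (hi : Odd i) : ∫ z in Metric.ball (0 : F) 1, φ z ^ i = 0 := by
  rw [← integral_indicator Metric.isOpen_ball.measurableSet]
  have h := integral_neg_eq_self ((Metric.ball (0 : F) 1).indicator fun z => φ z ^ i) volume
  have h2 : (fun z => (Metric.ball (0 : F) 1).indicator (fun z => φ z ^ i) (-z)) =
      fun z => -(Metric.ball (0 : F) 1).indicator (fun z => φ z ^ i) z := by
    funext z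
    by_cases hz : z ∈ Metric.ball (0 : F) 1
    · rw [indicator_of_mem hz, indicator_of_mem (by simpa using hz), map_neg, hi.neg_pow]
    · rw [indicator_of_notMem hz, indicator_of_notMem (by simpa using hz), neg_zero]
  rw [h2, integral_neg] at h
  linarith

/-- After rescaling to the unit ball the odd moments of `φ` vanish, so apart from `ρ ^ finrank` only
powers of `ρ²` occur. With `ρ² = 1 - t²` and even dimension the result is polynomial in `t`. -/
theorem integral_ball_add_pow {F : Type*} [NormedAddCommGroup F]
    [InnerProductSpace ℝ F] [FiniteDimensional ℝ F] [MeasurableSpace F] [BorelSpace F]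
    (φ : F →L[ℝ] ℝ) {ρ : ℝ} (hρ : 0 < ρ) (a : ℝ) (k : ℕ) :
    ∫ y in Metric.ball (0 : F) ρ, (a + φ y) ^ k = ρ ^ Module.finrank ℝ F *
      ∑ j ∈ Finset.range (k + 1), a ^ j * (ρ ^ 2) ^ ((k - j) / 2) *
        ((k.choose j : ℝ) * ∫ z in Metric.ball (0 : F) 1, φ z ^ (k - j)) := by
  have h1 := Measure.setIntegral_comp_smul_of_pos volume (fun y => (a + φ y) ^ k)
    (Metric.ball (0 : F) 1) hρ
  rw [smul_unitBall hρ.ne', Real.norm_of_nonneg hρ.le, smul_eq_mul, eq_inv_mul_iff_mul_eq₀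
    (pow_pos hρ _).ne'] at h1
  rw [← h1]
  congr 1
  have h2 : (fun z : F => (a + φ (ρ • z)) ^ k) = fun z => ∑ j ∈ Finset.range (k + 1),
      (a ^ j * ρ ^ (k - j) * (k.choose j : ℝ)) * φ z ^ (k - j) := by
    funext z
    rw [map_smul, smul_eq_mul, add_pow]
    refine Finset.sum_congr rfl fun j _ => ?_
    ring
  rw [h2, integral_finsetSum]
  · refine Finset.sum_congr rfl fun j _ => ?_
    rw [integral_const_mul]
    rcases Nat.even_or_odd (k - j) with he | ho
    · obtain ⟨i, hi⟩ := he
      rw [hi, ← two_mul, Nat.mul_div_cancel_left i two_pos, pow_mul]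
      ring
    -- For odd `k - j` the rounded exponent is harmless, since the integral is zero.
    · rw [integral_unitBall_inner_pow_odd φ ho]
      ring
  · intro j _
    exact Continuous.integrableOn_of_isBounded (by fun_prop) Metric.isBounded_ball

theorem smul_add_orthogonal_mem_ball {ω : EuclideanSpace ℝ (Fin n)} (hω : ‖ω‖ = 1) (t : ℝ)
    (y : (Submodule.span ℝ {ω})ᗮ) :
    t • ω + (y : EuclideanSpace ℝ (Fin n)) ∈ Metric.ball (0 : EuclideanSpace ℝ (Fin n)) 1 ↔
      t ^ 2 + ‖y‖ ^ 2 < 1 := by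
  have h1 : inner ℝ ω (y : EuclideanSpace ℝ (Fin n)) = 0 :=
    Submodule.mem_orthogonal_singleton_iff_inner_right.1 y.2
  have h2 : ‖t • ω + (y : EuclideanSpace ℝ (Fin n))‖ ^ 2 = t ^ 2 + ‖y‖ ^ 2 := by
    rw [norm_add_sq_real, real_inner_smul_left, h1, norm_smul, hω]
    simp
  rw [mem_ball_zero_iff, ← h2, sq_lt_one_iff₀ (norm_nonneg _)]

/-- The Radon transform of a ridge monomial on the unit ball of an odd-dimensional space. -/
theorem exists_radon_ball_ridge {m : ℕ} (hn : n = 2 * m + 1) {ω : EuclideanSpace ℝ (Fin n)}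
    (hω : ‖ω‖ = 1) (η : EuclideanSpace ℝ (Fin n)) (k : ℕ) :
    ∃ Q : ℝ[X], Q.natDegree ≤ k ∧ ∀ f : ℝ → ℝ, Continuous f →
      ∫ x in Metric.ball 0 1, f (inner ℝ ω x) * inner ℝ η x ^ k =
        ∫ t in (-1 : ℝ)..1, f t * ((1 - t ^ 2) ^ m * Q.eval t) := by
  set F := (Submodule.span ℝ {ω})ᗮ
  have : Fact (Module.finrank ℝ (EuclideanSpace ℝ (Fin n)) = 2 * m + 1) :=
    ⟨by rw [finrank_euclideanSpace_fin, hn]⟩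
  have hω0 : ω ≠ 0 := by
    rintro rfl
    simp at hω
  have hF : Module.finrank ℝ F = 2 * m := Submodule.finrank_orthogonal_span_singleton hω0
  set φ : F →L[ℝ] ℝ := (innerSL ℝ η).comp F.subtypeL with hφ
  set Q : ℝ[X] := ∑ j ∈ Finset.range (k + 1), (C (inner ℝ η ω ^ j) * X ^ j) *
    (1 - X ^ 2) ^ ((k - j) / 2) *
      C ((k.choose j : ℝ) * ∫ z in Metric.ball (0 : F) 1, φ z ^ (k - j)) with hQ
  refine ⟨Q, ?_, fun f hf => ?_⟩
  · apply natDegree_sum_le_of_forall_le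
    intro j hj
    rw [Finset.mem_range] at hj
    refine (natDegree_mul_C_le _ _).trans (natDegree_mul_le.trans ?_)
    have h1 : (C (inner ℝ η ω ^ j) * X ^ j : ℝ[X]).natDegree ≤ j := natDegree_C_mul_X_pow_le _ _
    have h2 : ((1 - X ^ 2 : ℝ[X]) ^ ((k - j) / 2)).natDegree ≤ (k - j) / 2 * 2 := by
      refine natDegree_pow_le.trans (Nat.mul_le_mul_left _ ?_)
      refine (natDegree_sub_le _ _).trans ?_
      simp
    omega
  · have hint : IntegrableOn (fun x => f (inner ℝ ω x) * inner ℝ η x ^ k)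
        (Metric.ball (0 : EuclideanSpace ℝ (Fin n)) 1) :=
      Continuous.integrableOn_of_isBounded (by fun_prop) Metric.isBounded_ball
    rw [← integral_indicator Metric.isOpen_ball.measurableSet, integral_eq_integral_slices hω
      (hint.integrable_indicator Metric.isOpen_ball.measurableSet),
      intervalIntegral.integral_of_le (by norm_num), integral_Ioc_eq_integral_Ioo,
      ← integral_indicator measurableSet_Ioo]
    congr 1
    funext t
    by_cases ht : t ∈ Ioo (-1 : ℝ) 1
    · have ht2 : 0 < 1 - t ^ 2 := by nlinarith [ht.1, ht.2]
      rw [indicator_of_mem ht]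
      have hρ : 0 < √(1 - t ^ 2) := Real.sqrt_pos.2 ht2
      have h1 : (fun y : F => (Metric.ball (0 : EuclideanSpace ℝ (Fin n)) 1).indicator
          (fun x => f (inner ℝ ω x) * inner ℝ η x ^ k) (t • ω + (y : EuclideanSpace ℝ (Fin n)))) =
          (Metric.ball (0 : F) √(1 - t ^ 2)).indicator
            fun y => f t * (t * inner ℝ η ω + φ y) ^ k := by
        funext y
        have hiff : t • ω + (y : EuclideanSpace ℝ (Fin n)) ∈
            Metric.ball (0 : EuclideanSpace ℝ (Fin n)) 1 ↔
            y ∈ Metric.ball (0 : F) √(1 - t ^ 2) := by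
          rw [smul_add_orthogonal_mem_ball hω, mem_ball_zero_iff, Real.lt_sqrt (norm_nonneg _)]
          constructor <;> intro h <;> linarith
        by_cases hy : y ∈ Metric.ball (0 : F) √(1 - t ^ 2)
        · rw [indicator_of_mem hy, indicator_of_mem (hiff.2 hy), inner_smul_add_orthogonal hω,
            inner_add_right, real_inner_smul_right]
          rfl
        · rw [indicator_of_notMem hy, indicator_of_notMem (fun h => hy (hiff.1 h))]
      rw [h1, integral_indicator Metric.isOpen_ball.measurableSet, integral_const_mul,
        integral_ball_add_pow φ hρ, hF, pow_mul, Real.sq_sqrt ht2.le, hQ, eval_finsetSum]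
      congr 2
      refine Finset.sum_congr rfl fun j _ => ?_
      simp only [eval_mul, eval_C, eval_pow, eval_X, eval_sub, eval_one]
      ring
    · rw [indicator_of_notMem ht]
      have h1 : (fun y : F => (Metric.ball (0 : EuclideanSpace ℝ (Fin n)) 1).indicator
          (fun x => f (inner ℝ ω x) * inner ℝ η x ^ k)
            (t • ω + (y : EuclideanSpace ℝ (Fin n)))) = fun _ => 0 := by
        funext y
        rw [indicator_of_notMem]
        rw [smul_add_orthogonal_mem_ball hω]
        intro h
        apply ht
        have : t ^ 2 < 1 := by nlinarith [sq_nonneg ‖y‖]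
        rw [sq_lt_one_iff_abs_lt_one, abs_lt] at this
        exact this
      rw [h1, integral_zero]

end Ball

/-! ### Weighted polynomials on an interval, and Fourier uniqueness -/

theorem X_sub_C_pow_dvd_of_abs_eval_le {P : ℝ[X]} {a K : ℝ} {m : ℕ} {l : Filter ℝ} [l.NeBot]
    (hl : l ≤ 𝓝[≠] a) (h : ∀ᶠ t in l, |P.eval t| ≤ K * |t - a| ^ m) : (X - C a) ^ m ∣ P := by
  by_cases hP : P = 0
  · rw [hP]
    exact dvd_zero _
  rw [← le_rootMultiplicity_iff hP]
  by_contra! hlt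
  obtain ⟨R, hR, hRa⟩ := exists_eq_pow_rootMultiplicity_mul_and_not_dvd P hP a
  set k := P.rootMultiplicity a
  apply hRa
  rw [dvd_iff_isRoot]
  have hl' : l ≤ 𝓝 a := hl.trans nhdsWithin_le_nhds
  have hne : ∀ᶠ t in l, t ≠ a := hl self_mem_nhdsWithin
  have hle : ∀ᶠ t in l, |R.eval t| ≤ K * |t - a| ^ (m - k) := by
    filter_upwards [h, hne] with t ht hta
    have hpos : 0 < |t - a| ^ k := pow_pos (abs_pos.2 (sub_ne_zero.2 hta)) k
    have h1 : |P.eval t| = |t - a| ^ k * |R.eval t| := by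
      rw [hR]
      simp [abs_mul, abs_pow]
    rw [h1] at ht
    have h2 : |t - a| ^ m = |t - a| ^ k * |t - a| ^ (m - k) := by
      rw [← pow_add, Nat.add_sub_cancel' hlt.le]
    rw [h2] at ht
    refine le_of_mul_le_mul_left ?_ hpos
    linarith
  have hR1 : Tendsto (fun t => |R.eval t|) l (𝓝 |R.eval a|) :=
    (R.continuous.abs.tendsto a).mono_left hl'
  have hc : Continuous fun t : ℝ => K * |t - a| ^ (m - k) := by fun_prop
  have hR2 : Tendsto (fun t => K * |t - a| ^ (m - k)) l (𝓝 0) := by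
    have := (hc.tendsto a).mono_left hl'
    simpa [(Nat.sub_pos_of_lt hlt).ne'] using this
  have := le_of_tendsto_of_tendsto hR1 hR2 hle
  exact abs_nonpos_iff.1 this

/-- A polynomial dominated on `(-1, 1)` by a multiple of `(1 - t²)^m` is divisible by it. -/
theorem exists_eq_one_sub_sq_pow_mul {P : ℝ[X]} {K : ℝ} {m : ℕ}
    (h : ∀ t ∈ Ioo (-1 : ℝ) 1, |P.eval t| ≤ K * (1 - t ^ 2) ^ m) :
    ∃ Q : ℝ[X], P = (1 - X ^ 2) ^ m * Q ∧ Q.natDegree ≤ P.natDegree := by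
  have hK : 0 ≤ K := by simpa using (abs_nonneg _).trans (h 0 (by norm_num))
  have h1 : (X - C (1 : ℝ)) ^ m ∣ P := by
    apply X_sub_C_pow_dvd_of_abs_eval_le (K := K * 2 ^ m) (l := 𝓝[<] (1 : ℝ))
      (nhdsLT_le_nhdsNE _)
    filter_upwards [Ioo_mem_nhdsLT (by norm_num : (-1 : ℝ) < 1)] with t ht
    refine (h t ht).trans ?_
    rw [mul_assoc, ← mul_pow, abs_of_neg (by linarith [ht.2] : t - 1 < 0)]
    have : 0 ≤ 1 - t ^ 2 := by nlinarith [ht.1, ht.2]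
    gcongr
    nlinarith [ht.1, ht.2]
  have h2 : (X - C (-1 : ℝ)) ^ m ∣ P := by
    apply X_sub_C_pow_dvd_of_abs_eval_le (K := K * 2 ^ m) (l := 𝓝[>] (-1 : ℝ))
      (nhdsGT_le_nhdsNE _)
    filter_upwards [Ioo_mem_nhdsGT (by norm_num : (-1 : ℝ) < 1)] with t ht
    refine (h t ht).trans ?_
    rw [mul_assoc, ← mul_pow, abs_of_pos (by linarith [ht.1] : 0 < t - -1)]
    have : 0 ≤ 1 - t ^ 2 := by nlinarith [ht.1, ht.2]
    gcongr
    nlinarith [ht.1, ht.2]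
  have hco : IsCoprime ((X - C (1 : ℝ)) ^ m) ((X - C (-1 : ℝ)) ^ m) :=
    (isCoprime_X_sub_C_of_isUnit_sub (by norm_num)).pow
  obtain ⟨R, hR⟩ := hco.mul_dvd h1 h2
  have hmon : ((X - C (1 : ℝ)) ^ m * (X - C (-1 : ℝ)) ^ m).Monic :=
    ((monic_X_sub_C _).pow m).mul ((monic_X_sub_C _).pow m)
  -- The sign turns `(X² - 1)^m` into `(1 - X²)^m`.
  refine ⟨C ((-1) ^ m) * R, ?_, ?_⟩
  · rw [hR, ← mul_pow, ← mul_assoc, C_pow, ← mul_pow]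
    congr 2
    simp only [map_neg, map_one]
    ring
  · refine (natDegree_C_mul_le _ _).trans ?_
    by_cases hR0 : R = 0
    · simp [hR0]
    · rw [hR, hmon.natDegree_mul' hR0]
      omega

/-- Test against the negative part of `g`. -/
theorem nonneg_of_integral_mul_nonneg {g : ℝ → ℝ} (hg : Continuous g) {a b : ℝ} (hab : a < b)
    (h : ∀ f : ℝ → ℝ, Continuous f → (∀ t, 0 ≤ f t) → 0 ≤ ∫ t in a..b, f t * g t) :
    ∀ t ∈ Icc a b, 0 ≤ g t := by
  intro t ht
  by_contra! hlt
  have h1 := h (fun t => max (-g t) 0) (by fun_prop) (fun t => le_max_right _ _)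
  have h2 : 0 < ∫ t in a..b, (max (-g t) 0) ^ 2 := by
    apply intervalIntegral.integral_pos hab (by fun_prop) (fun x _ => by positivity)
    exact ⟨t, ht, pow_pos (lt_max_of_lt_left (neg_pos.2 hlt)) 2⟩
  have h3 : (fun t => max (-g t) 0 * g t) = fun t => -(max (-g t) 0) ^ 2 := by
    funext t
    rcases le_total 0 (g t) with h0 | h0
    · rw [max_eq_right (by linarith)]
      ring
    · rw [max_eq_left (by linarith)]
      ring
  rw [h3, intervalIntegral.integral_neg] at h1
  linarith

/-- Uniqueness of a polynomial of degree at most `N` with given first moments for the weight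
`(1 - t²)^m` on `[-1, 1]`. -/
theorem eq_zero_of_weighted_moments_eq_zero {R : ℝ[X]} {N m : ℕ} (hR : R.natDegree ≤ N)
    (h : ∀ k ≤ N, ∫ t in (-1 : ℝ)..1, t ^ k * ((1 - t ^ 2) ^ m * R.eval t) = 0) : R = 0 := by
  -- Expanding one factor `R` in monomials reduces its weighted square integral to the given
  -- moments.
  have h1 : ∫ t in (-1 : ℝ)..1, (1 - t ^ 2) ^ m * R.eval t ^ 2 = 0 := by
    have h2 : (fun t : ℝ => (1 - t ^ 2) ^ m * R.eval t ^ 2) = fun t => ∑ k ∈ Finset.range (N + 1),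
        R.coeff k * (t ^ k * ((1 - t ^ 2) ^ m * R.eval t)) := by
      funext t
      have h3 : R.eval t = ∑ k ∈ Finset.range (N + 1), R.coeff k * t ^ k :=
        eval_eq_sum_range' (Nat.lt_succ_of_le hR) t
      calc (1 - t ^ 2) ^ m * R.eval t ^ 2
          = (∑ k ∈ Finset.range (N + 1), R.coeff k * t ^ k) * ((1 - t ^ 2) ^ m * R.eval t) := by
            rw [← h3]
            ring
        _ = _ := by
            rw [Finset.sum_mul]
            exact Finset.sum_congr rfl fun k _ => by ring
    rw [h2, intervalIntegral.integral_finsetSum]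
    · apply Finset.sum_eq_zero
      intro k hk
      rw [intervalIntegral.integral_const_mul, h k (Nat.lt_succ_iff.1 (Finset.mem_range.1 hk)),
        mul_zero]
    · intro k _
      exact Continuous.intervalIntegrable (by fun_prop) _ _
  by_contra hR0
  obtain ⟨c, hc, hcR⟩ : ∃ c ∈ Ioo (-1 : ℝ) 1, R.eval c ≠ 0 := by
    by_contra! hcon
    exact hR0 (eq_zero_of_infinite_isRoot R ((Ioo_infinite (by norm_num)).mono hcon))
  have h4 : 0 < ∫ t in (-1 : ℝ)..1, (1 - t ^ 2) ^ m * R.eval t ^ 2 := by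
    apply intervalIntegral.integral_pos (by norm_num) (by fun_prop)
    · intro t ht
      have : 0 ≤ 1 - t ^ 2 := by nlinarith [ht.1, ht.2]
      positivity
    · refine ⟨c, Ioo_subset_Icc_self hc, ?_⟩
      have : 0 < 1 - c ^ 2 := by nlinarith [hc.1, hc.2]
      positivity
  exact h4.ne' h1

/-- Integrable real functions with the same Fourier transform agree almost everywhere. -/
theorem ae_eq_of_cos_sin_integral_eq {E : Type*} [NormedAddCommGroup E] [InnerProductSpace ℝ E]
    [FiniteDimensional ℝ E] [MeasurableSpace E] [BorelSpace E] {u v : E → ℝ}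
    (hu : Integrable u) (hv : Integrable v)
    (hcos : ∀ ξ : E, ∫ x, Real.cos (inner ℝ ξ x) * u x = ∫ x, Real.cos (inner ℝ ξ x) * v x)
    (hsin : ∀ ξ : E, ∫ x, Real.sin (inner ℝ ξ x) * u x = ∫ x, Real.sin (inner ℝ ξ x) * v x) :
    u =ᵐ[volume] v := by
  -- Adding the same integrable function to both makes them densities of finite positive measures,
  -- which are determined by their characteristic functions.
  have hw : Integrable fun x => |u x| + |v x| := hu.abs.add hv.abs
  have hu' : Integrable fun x => u x + (|u x| + |v x|) := hu.add hw
  have hv' : Integrable fun x => v x + (|u x| + |v x|) := hv.add hw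
  have hu0 : ∀ x, 0 ≤ u x + (|u x| + |v x|) := fun x => by
    linarith [neg_abs_le (u x), abs_nonneg (v x)]
  have hv0 : ∀ x, 0 ≤ v x + (|u x| + |v x|) := fun x => by
    linarith [neg_abs_le (v x), abs_nonneg (u x)]
  have f1 := isFiniteMeasure_withDensity_ofReal hu'.2
  have f2 := isFiniteMeasure_withDensity_ofReal hv'.2
  have hcm : ∀ {h : E → ℝ}, Integrable h → ∀ ξ : E, Integrable fun x => Real.cos (inner ℝ ξ x) * h x :=
    fun hh ξ => hh.bdd_mul (c := 1) (by fun_prop : Continuous fun x : E =>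
      Real.cos (inner ℝ ξ x)).aestronglyMeasurable
      (Eventually.of_forall fun x => by simpa using Real.abs_cos_le_one _)
  have hsm : ∀ {h : E → ℝ}, Integrable h → ∀ ξ : E, Integrable fun x => Real.sin (inner ℝ ξ x) * h x :=
    fun hh ξ => hh.bdd_mul (c := 1) (by fun_prop : Continuous fun x : E =>
      Real.sin (inner ℝ ξ x)).aestronglyMeasurable
      (Eventually.of_forall fun x => by simpa using Real.abs_sin_le_one _)
  have hchar : ∀ {h : E → ℝ}, Integrable h → (∀ x, 0 ≤ h x) → ∀ ξ : E,
      charFun (volume.withDensity fun x => ENNReal.ofReal (h x)) ξ =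
        ((∫ x, Real.cos (inner ℝ ξ x) * h x : ℝ) : ℂ) +
          ((∫ x, Real.sin (inner ℝ ξ x) * h x : ℝ) : ℂ) * Complex.I := by
    intro h hh h0 ξ
    rw [charFun_apply, integral_withDensity_eq_integral_toReal_smul₀
      hh.1.aemeasurable.ennreal_ofReal (Eventually.of_forall fun x => ENNReal.ofReal_lt_top)]
    have h3 : (fun x => (ENNReal.ofReal (h x)).toReal • Complex.exp (inner ℝ x ξ * Complex.I)) =
        fun x => ((Real.cos (inner ℝ ξ x) * h x : ℝ) : ℂ) +
          ((Real.sin (inner ℝ ξ x) * h x : ℝ) : ℂ) * Complex.I := by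
      funext x
      rw [ENNReal.toReal_ofReal (h0 x), Complex.exp_mul_I, real_inner_comm, Complex.real_smul]
      push_cast
      ring
    rw [h3, integral_add ((hcm hh ξ).ofReal) (((hsm hh ξ).ofReal).mul_const _),
      integral_mul_const, integral_complex_ofReal, integral_complex_ofReal]
  have heq : (volume.withDensity fun x => ENNReal.ofReal (u x + (|u x| + |v x|))) =
      volume.withDensity fun x => ENNReal.ofReal (v x + (|u x| + |v x|)) := by
    apply Measure.ext_of_charFun
    funext ξ
    rw [hchar hu' hu0, hchar hv' hv0]
    simp only [mul_add (Real.cos _) (u _), mul_add (Real.sin _) (u _), mul_add (Real.cos _) (v _),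
      mul_add (Real.sin _) (v _)]
    rw [integral_add (hcm hu ξ) (hcm hw ξ), integral_add (hcm hv ξ) (hcm hw ξ),
      integral_add (hsm hu ξ) (hsm hw ξ), integral_add (hsm hv ξ) (hsm hw ξ), hcos, hsin]
  rw [withDensity_eq_iff_of_sigmaFinite hu'.1.aemeasurable.ennreal_ofReal
    hv'.1.aemeasurable.ennreal_ofReal] at heq
  filter_upwards [heq] with x hx
  rw [ENNReal.ofReal_eq_ofReal_iff (hu0 x) (hv0 x)] at hx
  linarith

/-! ### Polynomials on the ball and projection onto them -/

section Ridge

variable {n : ℕ}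

/-- The space of functions spanned by the ridge monomials `⟨η, x⟩ ^ k`, `k ≤ N`, restricted to the
unit ball and extended by zero. -/
def ridgeSpace (n N : ℕ) : Submodule ℝ (EuclideanSpace ℝ (Fin n) → ℝ) :=
  Submodule.span ℝ {g | ∃ (η : EuclideanSpace ℝ (Fin n)) (k : ℕ), k ≤ N ∧
    g = (Metric.ball 0 1).indicator fun x => inner ℝ η x ^ k}

theorem ridge_mem_ridgeSpace {N k : ℕ} (hk : k ≤ N) (η : EuclideanSpace ℝ (Fin n)) :
    ((Metric.ball 0 1).indicator fun x => inner ℝ η x ^ k) ∈ ridgeSpace n N :=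
  Submodule.subset_span ⟨η, k, hk, rfl⟩

instance finiteDimensional_ridgeSpace (n N : ℕ) : FiniteDimensional ℝ (ridgeSpace n N) := by
  set φ : (Σ k : Fin (N + 1), Fin k → Fin n) → EuclideanSpace ℝ (Fin n) → ℝ :=
    fun σ => (Metric.ball 0 1).indicator fun x => ∏ i, x (σ.2 i) with hφ
  have hfin : FiniteDimensional ℝ (Submodule.span ℝ (range φ)) :=
    FiniteDimensional.span_of_finite ℝ (finite_range φ)
  have hle : ridgeSpace n N ≤ Submodule.span ℝ (range φ) := by
    apply Submodule.span_le.2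
    rintro _ ⟨η, k, hk, rfl⟩
    have h1 : ((Metric.ball 0 1).indicator fun x => inner ℝ η x ^ k) =
        ∑ σ : Fin k → Fin n, (∏ i, η (σ i)) • φ ⟨⟨k, Nat.lt_succ_of_le hk⟩, σ⟩ := by
      funext x
      rw [Finset.sum_apply]
      by_cases hx : x ∈ Metric.ball (0 : EuclideanSpace ℝ (Fin n)) 1
      · simp only [hφ, Pi.smul_apply, indicator_of_mem hx, smul_eq_mul]
        rw [PiLp.inner_apply, Fintype.sum_pow]
        refine Finset.sum_congr rfl fun σ _ => ?_
        rw [← Finset.prod_mul_distrib]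
        refine Finset.prod_congr rfl fun i _ => ?_
        simp [mul_comm]
      · simp [hφ, indicator_of_notMem hx]
    rw [h1]
    exact Submodule.sum_mem _ fun σ _ => Submodule.smul_mem _ _ (Submodule.subset_span ⟨_, rfl⟩)
  exact Submodule.finiteDimensional_of_le hle

theorem exists_continuous_of_mem_ridgeSpace {N : ℕ} {p : EuclideanSpace ℝ (Fin n) → ℝ}
    (hp : p ∈ ridgeSpace n N) : ∃ p₀ : EuclideanSpace ℝ (Fin n) → ℝ, Continuous p₀ ∧
      p = (Metric.ball 0 1).indicator p₀ := by
  induction hp using Submodule.span_induction with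
  | mem g hg =>
    obtain ⟨η, k, -, rfl⟩ := hg
    exact ⟨_, by fun_prop, rfl⟩
  | zero => exact ⟨0, continuous_zero, by simp⟩
  | add p q _ _ hp hq =>
    obtain ⟨p₀, hp₀, rfl⟩ := hp
    obtain ⟨q₀, hq₀, rfl⟩ := hq
    exact ⟨p₀ + q₀, hp₀.add hq₀, (indicator_add' _ _ _).symm⟩
  | smul a p _ hp =>
    obtain ⟨p₀, hp₀, rfl⟩ := hp
    exact ⟨a • p₀, hp₀.const_smul a, (indicator_const_smul _ a p₀).symm⟩

theorem integrable_mul_of_mem_ridgeSpace {N : ℕ} {p : EuclideanSpace ℝ (Fin n) → ℝ}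
    (hp : p ∈ ridgeSpace n N) {f : EuclideanSpace ℝ (Fin n) → ℝ} (hf : Continuous f) :
    Integrable fun x => f x * p x := by
  obtain ⟨p₀, hp₀, rfl⟩ := exists_continuous_of_mem_ridgeSpace hp
  have h1 : (fun x => f x * (Metric.ball 0 1).indicator p₀ x) =
      (Metric.ball 0 1).indicator fun x => f x * p₀ x := by
    funext x
    by_cases hx : x ∈ Metric.ball (0 : EuclideanSpace ℝ (Fin n)) 1
    · simp [indicator_of_mem hx]
    · simp [indicator_of_notMem hx]
  rw [h1, integrable_indicator_iff Metric.isOpen_ball.measurableSet]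
  exact (hf.mul hp₀).integrableOn_of_isBounded Metric.isBounded_ball

theorem integrable_of_mem_ridgeSpace {N : ℕ} {p : EuclideanSpace ℝ (Fin n) → ℝ}
    (hp : p ∈ ridgeSpace n N) : Integrable p := by
  simpa using integrable_mul_of_mem_ridgeSpace hp (continuous_const (y := (1 : ℝ)))

theorem integrable_mul_mul_of_mem_ridgeSpace {N : ℕ} {p q : EuclideanSpace ℝ (Fin n) → ℝ}
    (hp : p ∈ ridgeSpace n N) (hq : q ∈ ridgeSpace n N) : Integrable fun x => p x * q x := by
  obtain ⟨p₀, hp₀, rfl⟩ := exists_continuous_of_mem_ridgeSpace hp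
  have h1 : (fun x => (Metric.ball 0 1).indicator p₀ x * q x) = fun x => p₀ x * q x := by
    obtain ⟨q₀, -, rfl⟩ := exists_continuous_of_mem_ridgeSpace hq
    funext x
    by_cases hx : x ∈ Metric.ball (0 : EuclideanSpace ℝ (Fin n)) 1
    · simp [indicator_of_mem hx]
    · simp [indicator_of_notMem hx]
  rw [h1]
  exact integrable_mul_of_mem_ridgeSpace hq hp₀

/-- Functions in the ridge space have Radon transform `(1 - t²)^m Q(t)`. -/
theorem exists_radon_of_mem_ridgeSpace {m N : ℕ} (hn : n = 2 * m + 1)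
    {ω : EuclideanSpace ℝ (Fin n)} (hω : ‖ω‖ = 1) {p : EuclideanSpace ℝ (Fin n) → ℝ}
    (hp : p ∈ ridgeSpace n N) : ∃ Q : ℝ[X], Q.natDegree ≤ N ∧ ∀ f : ℝ → ℝ, Continuous f →
      ∫ x, f (inner ℝ ω x) * p x = ∫ t in (-1 : ℝ)..1, f t * ((1 - t ^ 2) ^ m * Q.eval t) := by
  induction hp using Submodule.span_induction with
  | mem g hg =>
    obtain ⟨η, k, hk, rfl⟩ := hg
    obtain ⟨Q, hQ, hQf⟩ := exists_radon_ball_ridge hn hω η k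
    refine ⟨Q, hQ.trans hk, fun f hf => ?_⟩
    rw [← hQf f hf, ← integral_indicator Metric.isOpen_ball.measurableSet]
    congr 1
    funext x
    by_cases hx : x ∈ Metric.ball (0 : EuclideanSpace ℝ (Fin n)) 1
    · simp [indicator_of_mem hx]
    · simp [indicator_of_notMem hx]
  | zero => exact ⟨0, by simp, by simp⟩
  | add p q hpm hqm hp hq =>
    obtain ⟨P, hP, hPf⟩ := hp
    obtain ⟨Q, hQ, hQf⟩ := hq
    refine ⟨P + Q, natDegree_add_le_of_degree_le hP hQ, fun f hf => ?_⟩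
    simp only [Pi.add_apply, mul_add, eval_add]
    rw [integral_add (integrable_mul_of_mem_ridgeSpace hpm (by fun_prop))
      (integrable_mul_of_mem_ridgeSpace hqm (by fun_prop)), hPf f hf, hQf f hf,
      intervalIntegral.integral_add]
    · exact Continuous.intervalIntegrable (by fun_prop) _ _
    · exact Continuous.intervalIntegrable (by fun_prop) _ _
  | smul a p _ hp =>
    obtain ⟨P, hP, hPf⟩ := hp
    refine ⟨C a * P, (natDegree_C_mul_le _ _).trans hP, fun f hf => ?_⟩
    have h1 := hPf f hf
    simp only [Pi.smul_apply, smul_eq_mul, eval_mul, eval_C]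
    rw [show (fun x => f (inner ℝ ω x) * (a * p x)) = fun x => a * (f (inner ℝ ω x) * p x) by
      funext x; ring, integral_const_mul, h1, ← intervalIntegral.integral_const_mul]
    congr 1
    funext t
    ring

/-- Every domain in the unit ball has the same moments against the ridge space as some function of
that space. -/
theorem exists_ridgeSpace_projection (N : ℕ) {D : Set (EuclideanSpace ℝ (Fin n))} :
    ∃ p ∈ ridgeSpace n N, ∀ q ∈ ridgeSpace n N, ∫ x, p x * q x = ∫ x in D, q x := by
  -- The `L²` pairing is positive definite on this finite-dimensional space, so it represents every
  -- functional, in particular integration over `D`.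
  set b : ridgeSpace n N →ₗ[ℝ] Module.Dual ℝ (ridgeSpace n N) :=
    LinearMap.mk₂ ℝ (fun p q => ∫ x, p.1 x * q.1 x)
      (fun p p' q => by
        simp only [Submodule.coe_add, Pi.add_apply, add_mul]
        exact integral_add (integrable_mul_mul_of_mem_ridgeSpace p.2 q.2)
          (integrable_mul_mul_of_mem_ridgeSpace p'.2 q.2))
      (fun a p q => by
        simp only [Submodule.coe_smul, Pi.smul_apply, smul_eq_mul, mul_assoc]
        exact integral_const_mul _ _)
      (fun p q q' => by
        simp only [Submodule.coe_add, Pi.add_apply, mul_add]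
        exact integral_add (integrable_mul_mul_of_mem_ridgeSpace p.2 q.2)
          (integrable_mul_mul_of_mem_ridgeSpace p.2 q'.2))
      (fun a p q => by
        simp only [Submodule.coe_smul, Pi.smul_apply, smul_eq_mul, mul_left_comm _ a]
        exact integral_const_mul _ _) with hb
  have hinj : Function.Injective b := by
    rw [← LinearMap.ker_eq_bot, LinearMap.ker_eq_bot']
    intro p hp
    have h1 : ∫ x, p.1 x * p.1 x = 0 := LinearMap.congr_fun hp p
    rw [integral_eq_zero_iff_of_nonneg (fun x => mul_self_nonneg _)
      (integrable_mul_mul_of_mem_ridgeSpace p.2 p.2)] at h1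
    obtain ⟨p₀, hp₀, hpp⟩ := exists_continuous_of_mem_ridgeSpace p.2
    have h2 : EqOn p₀ 0 (Metric.ball 0 1) := by
      refine Measure.eqOn_open_of_ae_eq (μ := volume) ?_ Metric.isOpen_ball hp₀.continuousOn
        continuousOn_const
      rw [EventuallyEq, ae_restrict_iff' Metric.isOpen_ball.measurableSet]
      filter_upwards [h1] with x hx hxB
      rw [hpp] at hx
      simpa [indicator_of_mem hxB] using hx
    ext x
    rw [hpp]
    by_cases hx : x ∈ Metric.ball (0 : EuclideanSpace ℝ (Fin n)) 1
    · simpa [indicator_of_mem hx] using h2 hx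
    · simp [indicator_of_notMem hx]
  have hsurj : Function.Surjective b :=
    (LinearMap.injective_iff_surjective_of_finrank_eq_finrank Subspace.dual_finrank_eq.symm).1 hinj
  obtain ⟨p, hp⟩ := hsurj
    { toFun := fun q => ∫ x in D, q.1 x
      map_add' := fun q q' => integral_add (integrable_of_mem_ridgeSpace q.2).integrableOn
        (integrable_of_mem_ridgeSpace q'.2).integrableOn
      map_smul' := fun a q => integral_const_mul _ _ }
  exact ⟨p.1, p.2, fun q hq => LinearMap.congr_fun hp ⟨q, hq⟩⟩

end Ridge

/-! ### A set with the support functions of the unit ball -/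

section Normalized

variable {n : ℕ} {D : Set (EuclideanSpace ℝ (Fin n))}

theorem subset_unitBall_of_upperSupport (hD : IsOpen D) (hb : Bornology.IsBounded D)
    (hu : ∀ ξ, upperSupport D ξ = ‖ξ‖) : D ⊆ Metric.ball 0 1 := by
  intro x hx
  rw [mem_ball_zero_iff]
  by_cases hx0 : x = 0
  · simp [hx0]
  · have h1 := inner_lt_upperSupport hD hb hx hx0
    rw [hu, real_inner_self_eq_norm_sq] at h1
    have h2 := norm_pos_iff.2 hx0
    nlinarith

/-- The marginal densities of a domain with the support functions of the unit ball are divisible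
by `(1 - t²)^m`. -/
theorem PolyMarginals.exists_weighted_density {m N : ℕ} (hn : n = 2 * m + 1)
    (h : PolyMarginals N D) (hD : IsOpen D) (hb : Bornology.IsBounded D)
    (hu : ∀ ξ, upperSupport D ξ = ‖ξ‖) (hl : ∀ ξ, lowerSupport D ξ = -‖ξ‖)
    {ω : EuclideanSpace ℝ (Fin n)} (hω : ‖ω‖ = 1) :
    ∃ Q : ℝ[X], Q.natDegree ≤ N ∧ ∀ f : ℝ → ℝ, Continuous f →
      ∫ x in D, f (inner ℝ ω x) = ∫ t in (-1 : ℝ)..1, f t * ((1 - t ^ 2) ^ m * Q.eval t) := by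
  have hω0 : ω ≠ 0 := by
    rintro rfl
    simp at hω
  obtain ⟨P, hPN, hP⟩ := h ω hω0
  rw [hu, hl, hω] at hP
  -- Exponent zero gives the ball's own marginal density, `K * (1 - t²)^m`, which dominates that of
  -- `D`.
  obtain ⟨Q₀, hQ₀, hQ₀f⟩ := exists_radon_ball_ridge hn hω 0 0
  simp only [pow_zero, mul_one] at hQ₀f
  obtain ⟨K, hK⟩ : ∃ K, Q₀ = C K := ⟨_, eq_C_of_natDegree_le_zero hQ₀⟩
  simp only [hK, eval_C] at hQ₀f
  have hP0 : ∀ t ∈ Icc (-1 : ℝ) 1, 0 ≤ P.eval t := by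
    apply nonneg_of_integral_mul_nonneg P.continuous (by norm_num)
    intro f hf hf0
    rw [← hP f hf]
    exact integral_nonneg fun x => hf0 _
  have hPK : ∀ t ∈ Icc (-1 : ℝ) 1, 0 ≤ (1 - t ^ 2) ^ m * K - P.eval t := by
    apply nonneg_of_integral_mul_nonneg (by fun_prop) (by norm_num)
    intro f hf hf0
    simp only [mul_sub]
    rw [intervalIntegral.integral_sub (Continuous.intervalIntegrable (by fun_prop) _ _)
      (Continuous.intervalIntegrable (by fun_prop) _ _), ← hP f hf, ← hQ₀f f hf, sub_nonneg]
    apply setIntegral_mono_set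
    · exact Continuous.integrableOn_of_isBounded (by fun_prop) Metric.isBounded_ball
    · exact Eventually.of_forall fun x => hf0 _
    · exact (subset_unitBall_of_upperSupport hD hb hu).eventuallyLE
  obtain ⟨Q, hPQ, hQ⟩ := exists_eq_one_sub_sq_pow_mul (P := P) (K := K) (m := m) (by
    intro t ht
    have ht' := Ioo_subset_Icc_self ht
    rw [abs_of_nonneg (hP0 t ht')]
    linarith [hPK t ht'])
  refine ⟨Q, hQ.trans hPN, fun f hf => ?_⟩
  rw [hP f hf, hPQ]
  simp

/-- A bounded open set in odd dimension with polynomial marginals and the support functions of the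
unit ball fills the unit ball up to a null set. -/
theorem PolyMarginals.ae_mem_of_mem_unitBall {m N : ℕ} (hn : n = 2 * m + 1)
    (h : PolyMarginals N D) (hD : IsOpen D) (hne : D.Nonempty) (hb : Bornology.IsBounded D)
    (hu : ∀ ξ, upperSupport D ξ = ‖ξ‖) (hl : ∀ ξ, lowerSupport D ξ = -‖ξ‖) :
    ∀ᵐ x, x ∈ Metric.ball (0 : EuclideanSpace ℝ (Fin n)) 1 → x ∈ D := by
  have hsub := subset_unitBall_of_upperSupport hD hb hu
  obtain ⟨p, hp, hpq⟩ := exists_ridgeSpace_projection (n := n) N (D := D)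
  have key : ∀ ω : EuclideanSpace ℝ (Fin n), ‖ω‖ = 1 → ∀ f : ℝ → ℝ, Continuous f →
      ∫ x in D, f (inner ℝ ω x) = ∫ x, f (inner ℝ ω x) * p x := by
    intro ω hω f hf
    obtain ⟨Q, hQ, hQf⟩ := h.exists_weighted_density hn hD hb hu hl hω
    obtain ⟨Q', hQ', hQf'⟩ := exists_radon_of_mem_ridgeSpace hn hω hp
    -- The monomials `⟨ω, x⟩ ^ k` with `k ≤ N` lie in the ridge space, so `p` and the indicator of
    -- `D` pair equally with them; these moments determine the density.
    have hQQ : Q - Q' = 0 := by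
      apply eq_zero_of_weighted_moments_eq_zero (N := N) (m := m)
        ((natDegree_sub_le _ _).trans (max_le hQ hQ'))
      intro k hk
      simp only [eval_sub, mul_sub]
      rw [intervalIntegral.integral_sub (Continuous.intervalIntegrable (by fun_prop) _ _)
        (Continuous.intervalIntegrable (by fun_prop) _ _), ← hQf (fun t => t ^ k) (by fun_prop),
        ← hQf' (fun t => t ^ k) (by fun_prop), sub_eq_zero]
      have h1 := hpq _ (ridge_mem_ridgeSpace hk ω)
      have h2 : ∫ x in D, (Metric.ball 0 1).indicator (fun x => inner ℝ ω x ^ k) x =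
          ∫ x in D, inner ℝ ω x ^ k :=
        setIntegral_congr_fun hD.measurableSet fun x hx => indicator_of_mem (hsub hx) _
      rw [← h2, ← h1]
      congr 1
      funext x
      obtain ⟨p₀, -, rfl⟩ := exists_continuous_of_mem_ridgeSpace hp
      by_cases hx : x ∈ Metric.ball (0 : EuclideanSpace ℝ (Fin n)) 1
      · rw [indicator_of_mem hx, indicator_of_mem hx, mul_comm]
      · simp [indicator_of_notMem hx]
    rw [hQf f hf, hQf' f hf, sub_eq_zero.1 hQQ]
  have : Nonempty (Fin n) := ⟨⟨0, by omega⟩⟩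
  have key' : ∀ ξ : EuclideanSpace ℝ (Fin n), ∀ f : ℝ → ℝ, Continuous f →
      ∫ x, f (inner ℝ ξ x) * D.indicator 1 x = ∫ x, f (inner ℝ ξ x) * p x := by
    intro ξ f hf
    obtain ⟨ω, r, hω, rfl⟩ : ∃ (ω : EuclideanSpace ℝ (Fin n)) (r : ℝ), ‖ω‖ = 1 ∧ ξ = r • ω := by
      by_cases hξ : ξ = 0
      · obtain ⟨ω, hω⟩ := exists_norm_eq (EuclideanSpace ℝ (Fin n)) zero_le_one
        exact ⟨ω, 0, hω, by simp [hξ]⟩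
      · refine ⟨‖ξ‖⁻¹ • ξ, ‖ξ‖, norm_smul_inv_norm hξ, ?_⟩
        rw [smul_inv_smul₀ (norm_ne_zero_iff.2 hξ)]
    have h1 := key ω hω (fun t => f (r * t)) (by fun_prop)
    simp only [real_inner_smul_left]
    rw [← h1, ← integral_indicator hD.measurableSet]
    congr 1
    funext x
    by_cases hx : x ∈ D
    · simp [indicator_of_mem hx]
    · simp [indicator_of_notMem hx]
  have hint : Integrable (D.indicator (1 : EuclideanSpace ℝ (Fin n) → ℝ)) :=
    IntegrableOn.integrable_indicator
      (Continuous.integrableOn_of_isBounded continuous_one hb) hD.measurableSet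
  have hae := ae_eq_of_cos_sin_integral_eq hint (integrable_of_mem_ridgeSpace hp)
    (fun ξ => key' ξ _ Real.continuous_cos) (fun ξ => key' ξ _ Real.continuous_sin)
  obtain ⟨p₀, hp₀, rfl⟩ := exists_continuous_of_mem_ridgeSpace hp
  have hD1 : EqOn p₀ 1 D := by
    refine Measure.eqOn_open_of_ae_eq (μ := volume) ?_ hD hp₀.continuousOn continuousOn_const
    rw [EventuallyEq, ae_restrict_iff' hD.measurableSet]
    filter_upwards [hae] with x hx hxD
    rw [indicator_of_mem hxD, indicator_of_mem (hsub hxD)] at hx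
    exact hx.symm
  -- An a.e. equality of continuous functions on an open set holds everywhere, so `p₀` takes only
  -- the values 0 and 1 on the connected ball.
  have h01 : EqOn (fun x => p₀ x * (p₀ x - 1)) 0 (Metric.ball 0 1) := by
    refine Measure.eqOn_open_of_ae_eq (μ := volume) ?_ Metric.isOpen_ball
      (by fun_prop : Continuous fun x => p₀ x * (p₀ x - 1)).continuousOn continuousOn_const
    rw [EventuallyEq, ae_restrict_iff' Metric.isOpen_ball.measurableSet]
    filter_upwards [hae] with x hx hxB
    rw [indicator_of_mem hxB] at hx
    rw [← hx]
    by_cases hxD : x ∈ D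
    · simp [indicator_of_mem hxD]
    · simp [indicator_of_notMem hxD]
  obtain ⟨x₀, hx₀⟩ := hne
  have hone : ∀ x ∈ Metric.ball (0 : EuclideanSpace ℝ (Fin n)) 1, p₀ x = 1 := by
    intro x hx
    rw [(convex_ball (0 : EuclideanSpace ℝ (Fin n)) 1).isPreconnected.constant_of_mapsTo
      (T := ({0, 1} : Set ℝ)) (Set.toFinite _).isDiscrete hp₀.continuousOn ?_ hx (hsub hx₀)]
    · exact hD1 hx₀
    · intro y hy
      rcases mul_eq_zero.1 (h01 hy) with h0 | h0
      · exact Or.inl h0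
      · exact Or.inr (sub_eq_zero.1 h0)
  filter_upwards [hae] with x hx hxB
  by_contra hxD
  rw [indicator_of_notMem hxD, indicator_of_mem hxB, hone x hxB] at hx
  exact zero_ne_one hx

end Normalized

/-! ### Smooth boundary and conclusion -/

section Final

variable {n : ℕ} {D : Set (EuclideanSpace ℝ (Fin n))}

/-- A domain with smooth boundary has no slits: it coincides with every open set in which it is
dense. -/
theorem HasSmoothBoundary.eq_of_dense (hs : HasSmoothBoundary D) (hD : IsOpen D)
    {O : Set (EuclideanSpace ℝ (Fin n))} (hO : IsOpen O) (hDO : D ⊆ O) (hOD : O ⊆ closure D) :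
    D = O := by
  refine hDO.antisymm fun x hxO => ?_
  by_contra hxD
  have hfr : x ∈ frontier D := by
    rw [hD.frontier_eq]
    exact ⟨hOD hxO, hxD⟩
  obtain ⟨U, ρ, hU, hxU, hρ, hdρ, hUD⟩ := hs x hfr
  -- Density of `D` in `O` gives `ρ ≤ 0` near a missing point `x`, while `ρ x = 0`. So `x` is a
  -- local maximum, contradicting `dρ ≠ 0`.
  have hle : ∀ y ∈ U ∩ O, ρ y ≤ 0 := by
    rintro y ⟨hyU, hyO⟩
    by_contra! hpos
    have hev : ∀ᶠ z in 𝓝 y, 0 < ρ z :=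
      (hρ.continuousOn.continuousAt (hU.mem_nhds hyU)).eventually_const_lt hpos
    have hev2 : ∀ᶠ z in 𝓝 y, 0 < ρ z ∧ z ∈ U := hev.and (hU.mem_nhds hyU)
    obtain ⟨z, ⟨hz, hzU⟩, hzD⟩ := mem_closure_iff_nhds.1 (hOD hyO) _ hev2
    exact absurd ((hUD z hzU).1 hzD) (not_lt.2 hz.le)
  have hx0 : ρ x = 0 := by
    refine le_antisymm (hle x ⟨hxU, hxO⟩) ?_
    by_contra! hlt
    exact hxD ((hUD x hxU).2 hlt)
  apply hdρ
  apply IsLocalMax.fderiv_eq_zero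
  filter_upwards [(hU.inter hO).mem_nhds ⟨hxU, hxO⟩] with y hy
  rw [hx0]
  exact hle y hy

/-- The linear equivalence mapping the unit ball to the ellipsoid with axes `e j` and semi-axes
`b j`. -/
noncomputable def ellipsoidEquiv (e : OrthonormalBasis (Fin n) ℝ (EuclideanSpace ℝ (Fin n)))
    (b : Fin n → ℝ) (hb : ∀ j, b j ≠ 0) :
    EuclideanSpace ℝ (Fin n) ≃L[ℝ] EuclideanSpace ℝ (Fin n) :=
  ((((WithLp.linearEquiv 2 ℝ (Fin n → ℝ)).trans
    (LinearEquiv.piCongrRight fun j => LinearEquiv.smulOfNeZero ℝ ℝ (b j) (hb j))).trans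
      (WithLp.linearEquiv 2 ℝ (Fin n → ℝ)).symm).trans
        e.repr.symm.toLinearEquiv).toContinuousLinearEquiv

theorem inner_ellipsoidEquiv (e : OrthonormalBasis (Fin n) ℝ (EuclideanSpace ℝ (Fin n)))
    {b : Fin n → ℝ} (hb : ∀ j, b j ≠ 0) (y : EuclideanSpace ℝ (Fin n)) (j : Fin n) :
    inner ℝ (e j) (ellipsoidEquiv e b hb y) = b j * y j := by
  rw [← e.repr_apply_apply]
  change (e.repr (e.repr.symm (WithLp.toLp 2 fun j => b j • y j))) j = _
  rw [LinearIsometryEquiv.apply_symm_apply]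
  rfl

theorem isEllipsoid_of_polyMarginals {m N : ℕ} (hn : n = 2 * m + 1)
    (hD : IsSmoothBoundedDomain D) (h : PolyMarginals N D) : IsEllipsoid D := by
  obtain ⟨x₀, hx₀⟩ := hD.isConnected.nonempty
  set D₀ : Set (EuclideanSpace ℝ (Fin n)) :=
    {y | ContinuousLinearEquiv.refl ℝ (EuclideanSpace ℝ (Fin n)) y + x₀ ∈ D} with hD₀
  have hopen : ∀ {A : Set (EuclideanSpace ℝ (Fin n))}, IsOpen A →
      ∀ (L : EuclideanSpace ℝ (Fin n) ≃L[ℝ] EuclideanSpace ℝ (Fin n)) (c), IsOpen {y | L y + c ∈ A} :=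
    fun hA L c => hA.preimage (by fun_prop : Continuous fun y => L y + c)
  have hbdd : ∀ {A : Set (EuclideanSpace ℝ (Fin n))}, Bornology.IsBounded A →
      ∀ (L : EuclideanSpace ℝ (Fin n) ≃L[ℝ] EuclideanSpace ℝ (Fin n)) (c),
      Bornology.IsBounded {y | L y + c ∈ A} := by
    intro A hA L c
    obtain ⟨R, hR⟩ := hA.exists_norm_le
    refine (L.symm.lipschitz.isBounded_image
      (Metric.isBounded_closedBall (x := (0 : EuclideanSpace ℝ (Fin n))) (r := R + ‖c‖))).subset ?_
    intro y hy
    refine ⟨L y, ?_, L.symm_apply_apply y⟩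
    rw [mem_closedBall_zero_iff]
    have h1 := hR _ hy
    have h2 := norm_sub_le (L y + c) c
    rw [add_sub_cancel_right] at h2
    linarith
  have h0 : (0 : EuclideanSpace ℝ (Fin n)) ∈ D₀ := by simpa [hD₀] using hx₀
  have hD₀o : IsOpen D₀ := hopen hD.isOpen _ _
  have hD₀b : Bornology.IsBounded D₀ := hbdd hD.isBounded _ _
  have h₀ : PolyMarginals N D₀ := h.preimage_affine hD.isOpen ⟨x₀, hx₀⟩ hD.isBounded _ _
  obtain ⟨c, e, b, hbpos, hsupp⟩ := h₀.exists_ellipsoid_supports hD₀o h0 hD₀b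
  have hb0 : ∀ j, b j ≠ 0 := fun j => (hbpos j).ne'
  set L := ellipsoidEquiv e b hb0 with hL
  set D₁ : Set (EuclideanSpace ℝ (Fin n)) := {y | L y + c ∈ D₀} with hD₁
  have hD₁o : IsOpen D₁ := hopen hD₀o _ _
  have hD₁b : Bornology.IsBounded D₁ := hbdd hD₀b _ _
  have hD₁ne : D₁.Nonempty := ⟨L.symm (0 - c), by simpa [hD₁] using h0⟩
  have h₁ : PolyMarginals N D₁ := h₀.preimage_affine hD₀o ⟨0, h0⟩ hD₀b L c
  have hs₁ : ∀ η, upperSupport D₁ η = ‖η‖ ∧ lowerSupport D₁ η = -‖η‖ := by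
    intro η
    -- This is the inverse transpose of `L` applied to `η`.
    set ξ : EuclideanSpace ℝ (Fin n) := e.repr.symm (WithLp.toLp 2 fun j => η j / b j) with hξ
    have hξj : ∀ j, inner ℝ (e j) ξ = η j / b j := by
      intro j
      rw [← e.repr_apply_apply, hξ, LinearIsometryEquiv.apply_symm_apply]
    have hξL : ∀ y, inner ℝ ξ (L y) = inner ℝ η y := by
      intro y
      rw [← e.sum_inner_mul_inner, PiLp.inner_apply]
      refine Finset.sum_congr rfl fun j _ => ?_
      rw [real_inner_comm, hξj, hL, inner_ellipsoidEquiv]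
      have := hb0 j
      simp only [RCLike.inner_apply, conj_trivial]
      field_simp
    have hnorm : √(∑ j, b j ^ 2 * inner ℝ (e j) ξ ^ 2) = ‖η‖ := by
      rw [EuclideanSpace.norm_eq]
      congr 1
      refine Finset.sum_congr rfl fun j _ => ?_
      have := hb0 j
      rw [hξj, Real.norm_eq_abs, sq_abs]
      field_simp
    obtain ⟨k1, k2⟩ := supports_preimage_affine L c ⟨0, h0⟩ hD₀b hξL
    rw [k1, k2, (hsupp ξ).1, (hsupp ξ).2, hnorm]
    constructor <;> ring
  have hsub := subset_unitBall_of_upperSupport hD₁o hD₁b fun ξ => (hs₁ ξ).1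
  have hae := h₁.ae_mem_of_mem_unitBall hn hD₁o hD₁ne hD₁b (fun ξ => (hs₁ ξ).1)
    fun ξ => (hs₁ ξ).2
  -- A point of the ball outside the closure would have an open neighbourhood, of positive measure,
  -- missed by `D₁`.
  have hdense : Metric.ball 0 1 ⊆ closure D₁ := by
    intro x hx
    by_contra hxD
    have hO : IsOpen (Metric.ball 0 1 ∩ (closure D₁)ᶜ) :=
      Metric.isOpen_ball.inter isClosed_closure.isOpen_compl
    have hpos := hO.measure_pos volume ⟨x, hx, hxD⟩
    apply hpos.ne'
    refine measure_mono_null ?_ (ae_iff.1 hae)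
    rintro y ⟨hyB, hyD⟩
    rw [mem_ofPred_eq, Classical.not_imp]
    exact ⟨hyB, fun hy => hyD (subset_closure hy)⟩
  set Ell : Set (EuclideanSpace ℝ (Fin n)) :=
    {x | ∑ j, (inner ℝ (e j) (x - (c + x₀))) ^ 2 / (b j) ^ 2 < 1} with hEll
  have hmem : ∀ x, x ∈ Ell ↔ L.symm (x - (c + x₀)) ∈
      Metric.ball (0 : EuclideanSpace ℝ (Fin n)) 1 := by
    intro x
    set y := L.symm (x - (c + x₀)) with hy
    have hxy : x - (c + x₀) = L y := by rw [hy, L.apply_symm_apply]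
    rw [hEll, mem_ofPred_eq, hxy, mem_ball_zero_iff, ← sq_lt_one_iff₀ (norm_nonneg _),
      EuclideanSpace.real_norm_sq_eq]
    have : ∀ j, (inner ℝ (e j) (L y)) ^ 2 / (b j) ^ 2 = y j ^ 2 := by
      intro j
      have := hb0 j
      rw [hL, inner_ellipsoidEquiv]
      field_simp
    simp only [this]
  have hD₁mem : ∀ y, y ∈ D₁ ↔ L y + (c + x₀) ∈ D := by
    intro y
    rw [← add_assoc]
    rfl
  refine ⟨c + x₀, e, b, hbpos, ?_⟩
  apply hD.smoothBoundary.eq_of_dense hD.isOpen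
  · exact isOpen_lt (by fun_prop) continuous_const
  · intro x hx
    rw [hmem]
    apply hsub
    rw [hD₁mem]
    simpa using hx
  · intro x hx
    have h1 := hdense ((hmem x).1 hx)
    have h2 := (by fun_prop : Continuous fun y => L y + (c + x₀)).continuousAt.continuousWithinAt.mem_closure
      (t := D) h1 (fun y hy => (hD₁mem y).1 hy)
    simpa using h2

end Final

end

theorem theoremT (n : ℕ) (hn : Odd n) (D : Set (EuclideanSpace ℝ (Fin n)))
    (hD : IsSmoothBoundedDomain D)
    (N : ℕ) (a : ℕ → Metric.sphere (0 : EuclideanSpace ℝ (Fin n)) 1 → ℝ)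
    (hV : ∀ ω : Metric.sphere (0 : EuclideanSpace ℝ (Fin n)) 1,
      ∀ t ∈ Set.Ioo (lowerSupport D ω.1) (upperSupport D ω.1),
        sectionVolume D ω.1 t = ∑ k ∈ Finset.range (N + 1), a k ω * t ^ k)
    (ha : ∀ k : ℕ, n - 1 < k → k ≤ N →
      ∃ p : MvPolynomial (Fin n) ℝ, p.totalDegree ≤ k - (n - 1) ∧
        ∀ ω : Metric.sphere (0 : EuclideanSpace ℝ (Fin n)) 1,
          a k ω = MvPolynomial.eval (fun i => ω.1 i) p) :
    IsEllipsoid D := by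
  obtain ⟨m, hm⟩ := hn
  refine isEllipsoid_of_polyMarginals (N := N) hm hD (polyMarginals_of_sectionVolume hD.isOpen
    hD.isConnected.nonempty hD.isBounded fun ω hω => ?_)
  have hω' : ω ∈ Metric.sphere (0 : EuclideanSpace ℝ (Fin n)) 1 := by simpa using hω
  refine ⟨∑ k ∈ Finset.range (N + 1), Polynomial.C (a k ⟨ω, hω'⟩) * Polynomial.X ^ k, ?_, fun t ht => ?_⟩
  · apply Polynomial.natDegree_sum_le_of_forall_le
    intro k hk
    exact (Polynomial.natDegree_C_mul_X_pow_le _ _).trans (Nat.lt_succ_iff.1 (Finset.mem_range.1 hk))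
  · rw [hV ⟨ω, hω'⟩ t ht, Polynomial.eval_finsetSum]
    simp
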